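/- Let $n\ge 0$ be an integer, let $A,B\in\mathbb{C}^{n\times n}$ be Hermitian positive semidefinite, and let $N\in\mathbb{C}^{n\times n}$ be such that $A+N^*N$ is positive definite. For positive definite $X$ put $$f(X)=A+N^*(B+X^{-1})^{-1}N,\qquad L(X)=X^{-1}.$$ Let $Q_A,Q_B$ be the orthogonal projections onto the nullspaces of $A$ and $B$, let $M^\dagger$ denote the Moore–Penrose pseudoinverse of a matrix $M$, let $I$ be the identity matrix, $\operatorname{id}$ the identity map, and $\|\cdot\|$ the spectral norm. For a map $g$ of the positive definite matrices into themselves, its recession map is $g_\infty(X)=\lim_{t\to\infty}t^{-1}g(tX)$. Then $f$ maps the positive definite matrices into themselves, and the recession maps $f_\infty$ and $(LfL)_\infty$ (where $LfL = L\circ f\circ L$) exist at every positive definite $X$ and are given by $$f_\infty(X)=N^*(Q_BX^{-1}Q_B)^\dagger N,\qquad (LfL)_\infty(X)=(Q_AN^*X^{-1}NQ_A)^\dagger .$$ Call a positive definite $U$ a globally attracting fixed point of $f$ if $f(U)=U$ and $\lim_{k\to\infty}f^k(X)=U$ for every positive definite $X$; such a $U$ is necessarily the only positive definite fixed point of $f$.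 The map $f$ has a globally attracting positive definite fixed point if and only if there are integers $k,\ell>0$ such that $$\|(f_\infty+\operatorname{id})^k(I)\|<2^k\quad\text{and}\quad\|((LfL)_\infty+\operatorname{id})^\ell(I)\|<2^\ell ,$$ where powers of maps denote iterated composition. In particular, $f$ has a globally attracting positive definite fixed point if $$\|N^*Q_BN\|<1\quad\text{and}\quad\|(Q_AN^*NQ_A)^\dagger\|<1 .$$ -/

import Mathlib

open Matrix Filter Topology
open scoped Matrix.Norms.L2Operator ComplexOrder

namespace Riccati

noncomputable section

/-- `P` is a Moore-Penrose pseudoinverse of the square matrix `M` (the four Penrose equations). -/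
structure IsMoorePenrose {n : ℕ} (M P : Matrix (Fin n) (Fin n) ℂ) : Prop where
  mul_mul_left : M * P * M = M
  mul_mul_right : P * M * P = P
  isHermitian_left : (M * P).IsHermitian
  isHermitian_right : (P * M).IsHermitian

theorem IsMoorePenrose.eq {n : ℕ} {M P R : Matrix (Fin n) (Fin n) ℂ}
    (hP : IsMoorePenrose M P) (hR : IsMoorePenrose M R) : P = R := by
  have h1 : M * P = M * R := by
    calc M * P = (M * P)ᴴ := hP.isHermitian_left.eq.symm
      _ = ((M * R) * (M * P))ᴴ := by
          rw [← mul_assoc, hR.mul_mul_left]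
      _ = (M * P) * (M * R) := by
          rw [conjTranspose_mul, hP.isHermitian_left.eq, hR.isHermitian_left.eq]
      _ = M * R := by rw [← mul_assoc, hP.mul_mul_left]
  have h2 : P * M = R * M := by
    calc P * M = (P * M)ᴴ := hP.isHermitian_right.eq.symm
      _ = ((P * M) * (R * M))ᴴ := by
          rw [mul_assoc, ← mul_assoc M, hR.mul_mul_left]
      _ = (R * M) * (P * M) := by
          rw [conjTranspose_mul, hP.isHermitian_right.eq, hR.isHermitian_right.eq]
      _ = R * M := by rw [mul_assoc, ← mul_assoc M, hP.mul_mul_left]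
  calc P = P * M * P := hP.mul_mul_right.symm
    _ = R * (M * P) := by rw [h2, mul_assoc]
    _ = R := by rw [h1, ← mul_assoc, hR.mul_mul_right]

theorem exists_isMoorePenrose {n : ℕ} (M : Matrix (Fin n) (Fin n) ℂ) :
    ∃ P, IsMoorePenrose M P := by
  obtain ⟨G, hG, hGH, hc⟩ : ∃ G : Matrix (Fin n) (Fin n) ℂ, Gᴴ = G ∧
      G * (Mᴴ * M) * G = G ∧ (Mᴴ * M) * G * (Mᴴ * M) = Mᴴ * M ∧ G * (Mᴴ * M) = (Mᴴ * M) * G := by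
    have hH : IsSelfAdjoint (Mᴴ * M) := isHermitian_conjTranspose_mul_self M
    have hfin : (spectrum ℝ (Mᴴ * M)).Finite := Set.toFinite _
    have hco : ∀ g : ℝ → ℝ, ContinuousOn g (spectrum ℝ (Mᴴ * M)) := fun g =>
      hfin.continuousOn g
    have hid : cfc (fun x : ℝ => x) (Mᴴ * M) = Mᴴ * M := cfc_id' ℝ _
    refine ⟨cfc (fun x : ℝ => x⁻¹) (Mᴴ * M), ?_, ?_, ?_, ?_⟩
    · exact cfc_predicate (R := ℝ) (fun x : ℝ => x⁻¹) (Mᴴ * M)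
    · nth_rewrite 2 [← hid]
      rw [← cfc_mul _ _ _ (hco _) (hco _), ← cfc_mul _ _ _ (hco _) (hco _)]
      congr 1; ext x; by_cases hx : x = 0 <;> simp [hx]
    · nth_rewrite 1 [← hid]
      nth_rewrite 3 [← hid]
      rw [← cfc_mul _ _ _ (hco _) (hco _), ← cfc_mul _ _ _ (hco _) (hco _)]
      conv_rhs => rw [← hid]
      congr 1; ext x; by_cases hx : x = 0 <;> simp [hx]
    · have h1 := cfc_mul (fun x : ℝ => x⁻¹) (fun x : ℝ => x) (Mᴴ * M) (hco _) (hco _)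
      have h2 := cfc_mul (fun x : ℝ => x) (fun x : ℝ => x⁻¹) (Mᴴ * M) (hco _) (hco _)
      rw [hid] at h1 h2
      rw [← h1, ← h2]
      congr 1; ext x; ring
  obtain ⟨hc1, hc2⟩ := hc
  have hz : M * G * Mᴴ * M - M = 0 := by
    apply (conjTranspose_mul_self_eq_zero (A := M * G * Mᴴ * M - M)).1
    simp only [conjTranspose_sub, conjTranspose_mul, conjTranspose_conjTranspose, hG]
    have e1 : (Mᴴ * (M * (G * Mᴴ)) - Mᴴ) * (M * G * Mᴴ * M - M)
        = ((Mᴴ * M) * G * (Mᴴ * M)) * G * (Mᴴ * M) - (Mᴴ * M) * G * (Mᴴ * M)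
          - ((Mᴴ * M) * G * (Mᴴ * M)) + Mᴴ * M := by noncomm_ring
    rw [e1, hc1, hc1]; simp
  refine ⟨G * Mᴴ, ?_, ?_, ?_, ?_⟩
  · rw [← mul_assoc]; exact sub_eq_zero.1 hz
  · calc G * Mᴴ * M * (G * Mᴴ) = (G * (Mᴴ * M) * G) * Mᴴ := by noncomm_ring
      _ = _ := by rw [hGH]
  · simp [IsHermitian, conjTranspose_mul, hG, mul_assoc]
  · simp only [IsHermitian, conjTranspose_mul, hG, conjTranspose_conjTranspose]
    rw [mul_assoc, hc2, mul_assoc]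

/-- The Moore-Penrose pseudoinverse of a square complex matrix. -/
def pinv {n : ℕ} (M : Matrix (Fin n) (Fin n) ℂ) : Matrix (Fin n) (Fin n) ℂ :=
  (exists_isMoorePenrose M).choose

theorem isMoorePenrose_pinv {n : ℕ} (M : Matrix (Fin n) (Fin n) ℂ) :
    IsMoorePenrose M (pinv M) :=
  (exists_isMoorePenrose M).choose_spec

/-- The matrix of the orthogonal projection of `ℂⁿ` onto the nullspace of `A`. -/
def nullProj {n : ℕ} (A : Matrix (Fin n) (Fin n) ℂ) : Matrix (Fin n) (Fin n) ℂ :=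
  (Matrix.toEuclideanCLM (n := Fin n) (𝕜 := ℂ)).symm
    (LinearMap.ker (Matrix.toEuclideanLin A)).starProjection

/-- The map `f(X) = A + N* (B + X⁻¹)⁻¹ N`. -/
def riccatiMap {n : ℕ} (A B N X : Matrix (Fin n) (Fin n) ℂ) : Matrix (Fin n) (Fin n) ℂ :=
  A + Nᴴ * (B + X⁻¹)⁻¹ * N

/-- The conjugate `L ∘ f ∘ L` of `f` by the inversion `L(X) = X⁻¹`. -/
def invConj {n : ℕ} (f : Matrix (Fin n) (Fin n) ℂ → Matrix (Fin n) (Fin n) ℂ)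
    (X : Matrix (Fin n) (Fin n) ℂ) : Matrix (Fin n) (Fin n) ℂ :=
  (f X⁻¹)⁻¹

/-- `g` is the recession map of `f` on the positive definite matrices: the limit
`lim_{t → ∞} t⁻¹ f(t X)` exists and equals `g X` for each positive definite `X`. -/
def IsRecessionMap {n : ℕ} (f g : Matrix (Fin n) (Fin n) ℂ → Matrix (Fin n) (Fin n) ℂ) : Prop :=
  ∀ X : Matrix (Fin n) (Fin n) ℂ, X.PosDef →
    Tendsto (fun t : ℝ => t⁻¹ • f (t • X)) atTop (𝓝 (g X))

/-- The map `X ↦ N* (Q_B X⁻¹ Q_B)† N`. -/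
def recF {n : ℕ} (B N X : Matrix (Fin n) (Fin n) ℂ) : Matrix (Fin n) (Fin n) ℂ :=
  Nᴴ * pinv (nullProj B * X⁻¹ * nullProj B) * N

/-- The map `X ↦ (Q_A N* X⁻¹ N Q_A)†`. -/
def recLFL {n : ℕ} (A N X : Matrix (Fin n) (Fin n) ℂ) : Matrix (Fin n) (Fin n) ℂ :=
  pinv (nullProj A * Nᴴ * X⁻¹ * N * nullProj A)

/-- `U` is a fixed point of `f` among the positive definite matrices which attracts the `f`-orbit
of every positive definite matrix. -/
def IsGloballyAttractingFixedPoint {n : ℕ}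
    (f : Matrix (Fin n) (Fin n) ℂ → Matrix (Fin n) (Fin n) ℂ)
    (U : Matrix (Fin n) (Fin n) ℂ) : Prop :=
  U.PosDef ∧ f U = U ∧
    ∀ X : Matrix (Fin n) (Fin n) ℂ, X.PosDef → Tendsto (fun k : ℕ => f^[k] X) atTop (𝓝 U)

end

end Riccati

namespace Riccati

section

open scoped MatrixOrder

variable {n : ℕ}

/-! ### The Loewner order on positive definite matrices -/

/-! Both `f` and `LfL` are continuous, order preserving in the Loewner order and subhomogeneous. For
such a map `φ` with recession map `ψ`, pass to `F = (φ + id)/2` and `F_∞ = (ψ + id)/2`: the fixed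
points of `φ` are unchanged, `F_∞` preserves positive definiteness even where `ψ` is only
semidefinite, and the growth condition becomes `‖F_∞^k(I)‖ < 1`.

Sufficiency. The growth condition gives `F^k(tI) ≤ trI` with `r < 1` for all large `t`. This bounds
the fixed points of `φ` (`exists_norm_le_of_fixed`). Applied to `φ + 2I`, which has the same
recession map, it also yields a point with `φ V ≤ V` (`exists_map_le`). For `f` this is a
supersolution; for `LfL` its inverse is a subsolution of `f`. After scaling, monotone iteration
between the two produces a fixed point.

Uniqueness is special to the Riccati map. Fixed points satisfy `V - U = (Φ_V^j)* (V - U) Φ_U^j` with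
closed-loop matrices `Φ`. Powers of `Φ_V` are bounded. If `Φ_U` had an eigenvalue of modulus at
least 1, there would be a nonzero `W ≥ 0` with `U + sW` fixed for every `s ≥ 0`
(`exists_fixed_direction`), against boundedness; so `Φ_U^j → 0` and `V = U`. A unique fixed point
attracts every orbit, by squeezing between multiples of `U`.

Necessity. The fixed point is unique for `f`, and its inverse is unique for `LfL`. Hence it attracts
the orbits of `F` too, and `F_∞ ≤ F` with homogeneity of `F_∞` turns this into the norm inequality
(`exists_norm_add_id_iterate_lt`).

The recession formulas come from the limit of `(τB + S)⁻¹` as `τ → ∞` (`tendsto_inv_smul_add`). -/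

theorem posDef_of_le {X Y : Matrix (Fin n) (Fin n) ℂ} (hX : X.PosDef) (h : X ≤ Y) : Y.PosDef := by
  have := hX.add_posSemidef (Matrix.le_iff.1 h)
  rwa [add_sub_cancel] at this

theorem posDef_smul {X : Matrix (Fin n) (Fin n) ℂ} (hX : X.PosDef) {t : ℝ} (ht : 0 < t) :
    (t • X).PosDef :=
  hX.smul ht

theorem inv_le_inv_of_posDef {X Y : Matrix (Fin n) (Fin n) ℂ} (hX : X.PosDef) (h : X ≤ Y) :
    Y⁻¹ ≤ X⁻¹ := by
  rw [nonsing_inv_eq_ringInverse, nonsing_inv_eq_ringInverse]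
  exact CStarAlgebra.ringInverse_le_ringInverse h hX.isStrictlyPositive

theorem inv_real_smul (X : Matrix (Fin n) (Fin n) ℂ) {t : ℝ} (ht : t ≠ 0) :
    (t • X)⁻¹ = t⁻¹ • X⁻¹ := by
  by_cases hX : IsUnit X.det
  · refine inv_eq_left_inv ?_
    rw [smul_mul_smul_comm, nonsing_inv_mul _ hX, inv_mul_cancel₀ ht, one_smul]
  · have h2 : ¬ IsUnit (t • X).det := by
      intro h
      apply hX
      rw [← isUnit_iff_isUnit_det] at h ⊢
      have := h.smul (Units.mk0 t⁻¹ (inv_ne_zero ht))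
      rwa [Units.smul_def, Units.val_mk0, smul_smul, inv_mul_cancel₀ ht, one_smul] at this
    rw [nonsing_inv_apply_not_isUnit _ hX, nonsing_inv_apply_not_isUnit _ h2, smul_zero]

theorem inv_inv_of_posDef {X : Matrix (Fin n) (Fin n) ℂ} (hX : X.PosDef) : X⁻¹⁻¹ = X :=
  nonsing_inv_nonsing_inv _ ((isUnit_iff_isUnit_det _).1 hX.isUnit)

theorem mul_inv_of_posDef {X : Matrix (Fin n) (Fin n) ℂ} (hX : X.PosDef) : X * X⁻¹ = 1 :=
  mul_nonsing_inv _ ((isUnit_iff_isUnit_det _).1 hX.isUnit)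

theorem inv_mul_of_posDef {X : Matrix (Fin n) (Fin n) ℂ} (hX : X.PosDef) : X⁻¹ * X = 1 :=
  nonsing_inv_mul _ ((isUnit_iff_isUnit_det _).1 hX.isUnit)

theorem continuousAt_inv_of_posDef {X : Matrix (Fin n) (Fin n) ℂ} (hX : X.PosDef) :
    ContinuousAt (fun Y : Matrix (Fin n) (Fin n) ℂ => Y⁻¹) X := by
  have h : (fun Y : Matrix (Fin n) (Fin n) ℂ => Y⁻¹) = Ring.inverse := by
    funext Y; exact nonsing_inv_eq_ringInverse Y
  rw [h]
  exact NormedRing.inverse_continuousAt hX.isUnit.unit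

theorem exists_smul_one_le {X : Matrix (Fin n) (Fin n) ℂ} (hX : X.PosDef) :
    ∃ c : ℝ, 0 < c ∧ c • (1 : Matrix (Fin n) (Fin n) ℂ) ≤ X := by
  cases subsingleton_or_nontrivial (Matrix (Fin n) (Fin n) ℂ)
  · exact ⟨1, one_pos, (Subsingleton.elim _ _).le⟩
  obtain ⟨r, hr, h⟩ := (CFC.exists_pos_algebraMap_le_iff (A := Matrix (Fin n) (Fin n) ℂ)
    hX.isHermitian.isSelfAdjoint).2 fun x hx => hX.isStrictlyPositive.spectrum_pos hx
  exact ⟨r, hr, by rwa [Algebra.algebraMap_eq_smul_one] at h⟩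

theorem le_norm_smul_one {X : Matrix (Fin n) (Fin n) ℂ} (hX : X.IsHermitian) :
    X ≤ ‖X‖ • (1 : Matrix (Fin n) (Fin n) ℂ) := by
  have := IsSelfAdjoint.le_algebraMap_norm_self (a := X) hX.isSelfAdjoint
  rwa [Algebra.algebraMap_eq_smul_one] at this

theorem norm_le_of_le_smul_one {X : Matrix (Fin n) (Fin n) ℂ} (hX : 0 ≤ X) {c : ℝ} (hc : 0 ≤ c)
    (h : X ≤ c • (1 : Matrix (Fin n) (Fin n) ℂ)) : ‖X‖ ≤ c := by
  rw [CStarAlgebra.norm_le_iff_le_algebraMap X hc hX, Algebra.algebraMap_eq_smul_one]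
  exact h

theorem posDef_one : (1 : Matrix (Fin n) (Fin n) ℂ).PosDef := PosDef.one

theorem smul_one_le_smul_one {a b : ℝ} (h : a ≤ b) :
    a • (1 : Matrix (Fin n) (Fin n) ℂ) ≤ b • (1 : Matrix (Fin n) (Fin n) ℂ) :=
  smul_le_smul_of_nonneg_right h posDef_one.posSemidef.nonneg

theorem exists_one_le_and_le_smul {X U : Matrix (Fin n) (Fin n) ℂ} (hX : X.PosDef) (hU : U.PosDef) :
    ∃ τ : ℝ, 1 ≤ τ ∧ X ≤ τ • U := by
  obtain ⟨c, hc, h⟩ := exists_smul_one_le hU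
  refine ⟨max 1 (‖X‖ / c), le_max_left _ _, ?_⟩
  calc X ≤ ‖X‖ • 1 := le_norm_smul_one hX.isHermitian
    _ = (‖X‖ / c) • c • (1 : Matrix (Fin n) (Fin n) ℂ) := by
        rw [smul_smul, div_mul_cancel₀ _ hc.ne']
    _ ≤ (‖X‖ / c) • U := smul_le_smul_of_nonneg_left h (by positivity)
    _ ≤ _ := smul_le_smul_of_nonneg_right (le_max_right _ _) hU.posSemidef.nonneg

theorem eventually_le_of_tendsto {ι : Type*} {l : Filter ι} {Y : ι → Matrix (Fin n) (Fin n) ℂ}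
    {Z W : Matrix (Fin n) (Fin n) ℂ} (hY : Tendsto Y l (𝓝 Z)) (hZ : Z.IsHermitian)
    (hYh : ∀ᶠ i in l, (Y i).IsHermitian) (hW : (W - Z).PosDef) : ∀ᶠ i in l, Y i ≤ W := by
  obtain ⟨c, hc, h⟩ := exists_smul_one_le hW
  have h0 : Tendsto (fun i => ‖Y i - Z‖) l (𝓝 0) := by
    have := (hY.sub_const Z).norm
    simpa using this
  filter_upwards [hYh, h0.eventually_lt_const hc] with i hi hlt
  have h1 : Y i - Z ≤ W - Z :=
    (le_norm_smul_one (hi.sub hZ)).trans ((smul_one_le_smul_one hlt.le).trans h)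
  simpa using h1

theorem exists_tendsto_of_antitone {X : ℕ → Matrix (Fin n) (Fin n) ℂ} (hX : Antitone X)
    {Z : Matrix (Fin n) (Fin n) ℂ} (hZ : ∀ k, Z ≤ X k) :
    ∃ U, Z ≤ U ∧ (∀ k, U ≤ X k) ∧ Tendsto X atTop (𝓝 U) := by
  have hb : ∀ k, X k ∈ Metric.closedBall Z ‖X 0 - Z‖ := fun k => by
    rw [mem_closedBall_iff_norm]
    exact CStarAlgebra.norm_le_norm_of_nonneg_of_le (sub_nonneg.2 (hZ k))
      (sub_le_sub_right (hX (Nat.zero_le k)) Z)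
  have : ProperSpace (Matrix (Fin n) (Fin n) ℂ) := FiniteDimensional.proper_real _
  obtain ⟨U, -, φ, hφ, hU⟩ := (isCompact_closedBall Z ‖X 0 - Z‖).tendsto_subseq hb
  have hle : ∀ k, U ≤ X k := fun k => le_of_tendsto hU (by
    filter_upwards [eventually_ge_atTop k] with j hj
    exact hX (hj.trans (hφ.id_le j)))
  refine ⟨U, ge_of_tendsto' hU fun j => hZ _, hle, ?_⟩
  -- Since `0 ≤ X k - U` decreases in `k`, so does its norm; convergence of the subsequence
  -- therefore forces that of the whole sequence.
  rw [tendsto_iff_norm_sub_tendsto_zero] at hU ⊢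
  rw [Metric.tendsto_atTop] at hU ⊢
  intro ε hε
  obtain ⟨J, hJ⟩ := hU ε hε
  refine ⟨φ J, fun k hk => ?_⟩
  refine lt_of_le_of_lt ?_ (hJ J le_rfl)
  simp only [dist_zero_right, norm_norm, Function.comp]
  exact CStarAlgebra.norm_le_norm_of_nonneg_of_le (sub_nonneg.2 (hle k))
    (sub_le_sub_right (hX hk) U)

end

section

open scoped MatrixOrder

variable {n : ℕ}

/-! ### Order-preserving subhomogeneous maps -/

/-- A continuous order-preserving subhomogeneous self-map of the positive definite matrices. -/
structure IsSubhomogeneous (φ : Matrix (Fin n) (Fin n) ℂ → Matrix (Fin n) (Fin n) ℂ) : Prop where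
  posDef : ∀ X, X.PosDef → (φ X).PosDef
  mono : ∀ X Y, X.PosDef → X ≤ Y → φ X ≤ φ Y
  map_smul_le : ∀ X (t : ℝ), X.PosDef → 1 ≤ t → φ (t • X) ≤ t • φ X
  continuousAt : ∀ X, X.PosDef → ContinuousAt φ X

/-- The average of a map and the identity. -/
noncomputable def average (φ : Matrix (Fin n) (Fin n) ℂ → Matrix (Fin n) (Fin n) ℂ)
    (X : Matrix (Fin n) (Fin n) ℂ) : Matrix (Fin n) (Fin n) ℂ :=
  (1 / 2 : ℝ) • (φ X + X)

variable {φ ψ : Matrix (Fin n) (Fin n) ℂ → Matrix (Fin n) (Fin n) ℂ}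

theorem average_eq_self_iff {X : Matrix (Fin n) (Fin n) ℂ} : average φ X = X ↔ φ X = X := by
  unfold average
  constructor
  · intro h
    have h2 : (2 : ℝ) • ((1 / 2 : ℝ) • (φ X + X)) = (2 : ℝ) • X := by rw [h]
    rw [smul_smul, two_smul] at h2
    norm_num at h2
    exact h2
  · intro h
    rw [h, ← two_smul ℝ X, smul_smul]
    norm_num

namespace IsSubhomogeneous

theorem le_map_smul (hφ : IsSubhomogeneous φ) {X : Matrix (Fin n) (Fin n) ℂ} (hX : X.PosDef)
    {s : ℝ} (hs : 0 < s) (hs1 : s ≤ 1) : s • φ X ≤ φ (s • X) := by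
  have h := hφ.map_smul_le (s • X) s⁻¹ (posDef_smul hX hs) ((one_le_inv₀ hs).2 hs1)
  rw [smul_smul, inv_mul_cancel₀ hs.ne', one_smul] at h
  have h2 := smul_le_smul_of_nonneg_left h hs.le
  rwa [smul_smul, mul_inv_cancel₀ hs.ne', one_smul] at h2

theorem average (hφ : IsSubhomogeneous φ) : IsSubhomogeneous (average φ) where
  posDef X hX := posDef_smul ((hφ.posDef X hX).add hX) (by norm_num)
  mono X Y hX h :=
    smul_le_smul_of_nonneg_left (add_le_add (hφ.mono X Y hX h) h) (by norm_num)
  map_smul_le X t hX ht := by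
    unfold Riccati.average
    rw [smul_comm t, smul_add t]
    exact smul_le_smul_of_nonneg_left (add_le_add_left (hφ.map_smul_le X t hX ht) _) (by norm_num)
  continuousAt X hX := by
    have h : ContinuousAt (fun Y => φ Y + Y) X := (hφ.continuousAt X hX).add continuousAt_id
    exact h.const_smul (1 / 2 : ℝ)

theorem add_smul_one (hφ : IsSubhomogeneous φ) {ε : ℝ} (hε : 0 < ε) :
    IsSubhomogeneous fun X => φ X + ε • (1 : Matrix (Fin n) (Fin n) ℂ) where
  posDef X hX := (hφ.posDef X hX).add (posDef_smul posDef_one hε)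
  mono X Y hX h := add_le_add_left (hφ.mono X Y hX h) _
  map_smul_le X t hX ht := by
    rw [smul_add, smul_smul]
    exact add_le_add (hφ.map_smul_le X t hX ht) (smul_one_le_smul_one (by nlinarith))
  continuousAt X hX := (hφ.continuousAt X hX).add continuousAt_const

theorem iterate (hφ : IsSubhomogeneous φ) (k : ℕ) : IsSubhomogeneous φ^[k] := by
  induction k with
  | zero =>
    exact ⟨fun X hX => hX, fun X Y _ h => h, fun X t _ _ => le_rfl, fun X _ => continuousAt_id⟩
  | succ k ih =>
    rw [Function.iterate_succ']
    refine ⟨fun X hX => hφ.posDef _ (ih.posDef X hX),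
      fun X Y hX h => hφ.mono _ _ (ih.posDef X hX) (ih.mono X Y hX h), fun X t hX ht => ?_,
      fun X hX => (hφ.continuousAt _ (ih.posDef X hX)).comp (ih.continuousAt X hX)⟩
    exact (hφ.mono _ _ (ih.posDef _ (posDef_smul hX (by linarith)))
      (ih.map_smul_le X t hX ht)).trans (hφ.map_smul_le _ t (ih.posDef X hX) ht)

theorem exists_tendsto_of_map_le (hφ : IsSubhomogeneous φ) {Y Z : Matrix (Fin n) (Fin n) ℂ}
    (hZ : Z.PosDef) (hZY : Z ≤ Y) (hY : φ Y ≤ Y) (hZφ : Z ≤ φ Z) :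
    ∃ U, U.PosDef ∧ Z ≤ U ∧ φ U = U ∧ Tendsto (fun k => φ^[k] Y) atTop (𝓝 U) := by
  have hYp := posDef_of_le hZ hZY
  have hle : ∀ k, Z ≤ φ^[k] Y := fun k => by
    induction k with
    | zero => exact hZY
    | succ k ih =>
      rw [Function.iterate_succ_apply']
      exact hZφ.trans (hφ.mono _ _ hZ ih)
  have hanti : Antitone fun k => φ^[k] Y := antitone_nat_of_succ_le fun k => by
    rw [Function.iterate_succ_apply]
    exact (hφ.iterate k).mono _ _ (hφ.posDef _ hYp) hY
  obtain ⟨U, hZU, -, hU⟩ := exists_tendsto_of_antitone hanti hle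
  have hUp := posDef_of_le hZ hZU
  refine ⟨U, hUp, hZU, ?_, hU⟩
  have h1 := (tendsto_add_atTop_iff_nat 1).2 hU
  simp only [Function.iterate_succ_apply'] at h1
  exact tendsto_nhds_unique ((hφ.continuousAt U hUp).tendsto.comp hU) h1

theorem exists_tendsto_of_le_map (hφ : IsSubhomogeneous φ) {Y Z : Matrix (Fin n) (Fin n) ℂ}
    (hZ : Z.PosDef) (hZY : Z ≤ Y) (hY : φ Y ≤ Y) (hZφ : Z ≤ φ Z) :
    ∃ U, U.PosDef ∧ U ≤ Y ∧ φ U = U ∧ Tendsto (fun k => φ^[k] Z) atTop (𝓝 U) := by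
  have hp : ∀ k, (φ^[k] Z).PosDef := fun k => (hφ.iterate k).posDef Z hZ
  have hle : ∀ k, φ^[k] Z ≤ Y := fun k => by
    induction k with
    | zero => exact hZY
    | succ k ih =>
      rw [Function.iterate_succ_apply']
      exact (hφ.mono _ _ (hp k) ih).trans hY
  have hmono : Monotone fun k => φ^[k] Z := monotone_nat_of_le_succ fun k => by
    rw [Function.iterate_succ_apply]
    exact (hφ.iterate k).mono _ _ hZ hZφ
  obtain ⟨V, hYV, hV, hlim⟩ := exists_tendsto_of_antitone (X := fun k => -φ^[k] Z)
    (fun i j h => neg_le_neg (hmono h)) (fun k => neg_le_neg (hle k))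
  have hU : Tendsto (fun k => φ^[k] Z) atTop (𝓝 (-V)) := by simpa using hlim.neg
  have hUp : (-V).PosDef := posDef_of_le hZ (by simpa using neg_le_neg (hV 0))
  refine ⟨-V, hUp, by simpa using neg_le_neg hYV, ?_, hU⟩
  have h1 := (tendsto_add_atTop_iff_nat 1).2 hU
  simp only [Function.iterate_succ_apply'] at h1
  exact tendsto_nhds_unique ((hφ.continuousAt _ hUp).tendsto.comp hU) h1

/-- A subhomogeneous map with a single positive definite fixed point has globally convergent
iterates. -/
theorem isGloballyAttractingFixedPoint (hφ : IsSubhomogeneous φ)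
    {U : Matrix (Fin n) (Fin n) ℂ} (hU : U.PosDef) (hfix : φ U = U)
    (huniq : ∀ V : Matrix (Fin n) (Fin n) ℂ, V.PosDef → φ V = V → V = U) :
    IsGloballyAttractingFixedPoint φ U := by
  refine ⟨hU, hfix, fun X hX => ?_⟩
  -- Trap `X` between `σ⁻¹ • U`, a subsolution, and `τ • U`, a supersolution; both monotone orbits
  -- converge to fixed points, hence to `U`.
  obtain ⟨τ, hτ, hXτ⟩ := exists_one_le_and_le_smul hX hU
  obtain ⟨σ, hσ, hUσ⟩ := exists_one_le_and_le_smul hU hX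
  have hσ0 : 0 < σ := by linarith
  have hσ1 : σ⁻¹ ≤ 1 := inv_le_one_of_one_le₀ hσ
  have hUX : σ⁻¹ • U ≤ X := by
    have := smul_le_smul_of_nonneg_left hUσ (inv_pos.2 hσ0).le
    rwa [smul_smul, inv_mul_cancel₀ hσ0.ne', one_smul] at this
  have hlow : (σ⁻¹ • U).PosDef := posDef_smul hU (inv_pos.2 hσ0)
  have h1 : φ (τ • U) ≤ τ • U := by
    have := hφ.map_smul_le U τ hU hτ
    rwa [hfix] at this
  have h2 : σ⁻¹ • U ≤ φ (σ⁻¹ • U) := by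
    have := hφ.le_map_smul hU (inv_pos.2 hσ0) hσ1
    rwa [hfix] at this
  obtain ⟨V, hV, -, hVfix, hVlim⟩ :=
    hφ.exists_tendsto_of_map_le hlow (hUX.trans hXτ) h1 h2
  obtain ⟨W, hW, -, hWfix, hWlim⟩ :=
    hφ.exists_tendsto_of_le_map hlow (hUX.trans hXτ) h1 h2
  rw [huniq V hV hVfix] at hVlim
  rw [huniq W hW hWfix] at hWlim
  have hl : ∀ k, φ^[k] (σ⁻¹ • U) ≤ φ^[k] X := fun k => (hφ.iterate k).mono _ _ hlow hUX
  have hr : ∀ k, φ^[k] X ≤ φ^[k] (τ • U) := fun k => (hφ.iterate k).mono _ _ hX hXτ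
  have hsub := hVlim.sub hWlim
  rw [sub_self] at hsub
  have hz : Tendsto (fun k => φ^[k] X - φ^[k] (σ⁻¹ • U)) atTop (𝓝 0) := by
    refine squeeze_zero_norm (fun k => ?_) (by simpa using hsub.norm)
    exact CStarAlgebra.norm_le_norm_of_nonneg_of_le (sub_nonneg.2 (hl k))
      (sub_le_sub_right (hr k) _)
  simpa using hz.add hWlim

end IsSubhomogeneous

/-! ### Recession maps -/

theorem tendsto_inv_smul_of_isRecessionMap (hψ : IsRecessionMap φ ψ)
    {X : Matrix (Fin n) (Fin n) ℂ} (hX : X.PosDef) :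
    Tendsto (fun t : ℝ => t⁻¹ • average φ (t • X)) atTop (𝓝 (average ψ X)) := by
  have h : Tendsto (fun t : ℝ => (1 / 2 : ℝ) • (t⁻¹ • φ (t • X) + X)) atTop
      (𝓝 (average ψ X)) := ((hψ X hX).add_const X).const_smul _
  refine h.congr' ?_
  filter_upwards [eventually_gt_atTop 0] with t ht
  unfold average
  rw [smul_comm t⁻¹, smul_add t⁻¹, smul_smul t⁻¹ t, inv_mul_cancel₀ ht.ne', one_smul]

theorem IsRecessionMap.average (hψ : IsRecessionMap φ ψ) :
    IsRecessionMap (average φ) (average ψ) :=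
  fun _ hX => tendsto_inv_smul_of_isRecessionMap hψ hX

theorem IsRecessionMap.add_const (hψ : IsRecessionMap φ ψ) (C : Matrix (Fin n) (Fin n) ℂ) :
    IsRecessionMap (fun X => φ X + C) ψ := fun X hX => by
  have h := (hψ X hX).add (tendsto_inv_atTop_zero.smul_const C)
  simpa [smul_add] using h

namespace IsRecessionMap

theorem nonneg (hψ : IsRecessionMap φ ψ) (hφ : IsSubhomogeneous φ)
    {X : Matrix (Fin n) (Fin n) ℂ} (hX : X.PosDef) : 0 ≤ ψ X := by
  refine ge_of_tendsto (hψ X hX) ?_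
  filter_upwards [eventually_gt_atTop 0] with t ht
  exact (posDef_smul (hφ.posDef _ (posDef_smul hX ht)) (inv_pos.2 ht)).posSemidef.nonneg

theorem le (hψ : IsRecessionMap φ ψ) (hφ : IsSubhomogeneous φ)
    {X : Matrix (Fin n) (Fin n) ℂ} (hX : X.PosDef) : ψ X ≤ φ X := by
  refine le_of_tendsto (hψ X hX) ?_
  filter_upwards [eventually_ge_atTop 1] with t ht
  have ht0 : 0 < t := by linarith
  have := smul_le_smul_of_nonneg_left (hφ.map_smul_le X t hX ht) (inv_pos.2 ht0).le
  rwa [smul_smul, inv_mul_cancel₀ ht0.ne', one_smul] at this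

theorem map_smul (hψ : IsRecessionMap φ ψ) {X : Matrix (Fin n) (Fin n) ℂ} (hX : X.PosDef)
    {s : ℝ} (hs : 0 < s) : ψ (s • X) = s • ψ X := by
  have h1 := hψ (s • X) (posDef_smul hX hs)
  have h2 := ((hψ X hX).comp (tendsto_id.atTop_mul_const hs)).const_smul s
  refine tendsto_nhds_unique h1 (h2.congr fun t => ?_)
  simp only [Function.comp, id]
  rw [smul_smul, smul_smul, mul_inv, mul_comm t⁻¹, ← mul_assoc, mul_inv_cancel₀ hs.ne', one_mul]

theorem average_posDef (hψ : IsRecessionMap φ ψ) (hφ : IsSubhomogeneous φ)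
    {X : Matrix (Fin n) (Fin n) ℂ} (hX : X.PosDef) : (Riccati.average ψ X).PosDef :=
  posDef_smul (hX.posSemidef_add (hψ.nonneg hφ hX).posSemidef) (by norm_num)

theorem average_iterate_posDef (hψ : IsRecessionMap φ ψ) (hφ : IsSubhomogeneous φ)
    {X : Matrix (Fin n) (Fin n) ℂ} (hX : X.PosDef) (k : ℕ) :
    ((Riccati.average ψ)^[k] X).PosDef := by
  induction k with
  | zero => exact hX
  | succ k ih =>
    rw [Function.iterate_succ_apply']
    exact hψ.average_posDef hφ ih

theorem add_id_iterate (hψ : IsRecessionMap φ ψ) (hφ : IsSubhomogeneous φ)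
    {X : Matrix (Fin n) (Fin n) ℂ} (hX : X.PosDef) (k : ℕ) :
    (fun X => ψ X + X)^[k] X = (2 : ℝ) ^ k • (Riccati.average ψ)^[k] X := by
  induction k with
  | zero => simp
  | succ k ih =>
    rw [Function.iterate_succ_apply', Function.iterate_succ_apply', ih,
      hψ.map_smul (hψ.average_iterate_posDef hφ hX k) (by positivity), ← smul_add, pow_succ,
      mul_smul]
    congr 1
    unfold Riccati.average
    rw [smul_smul]
    norm_num

theorem norm_add_id_iterate_lt_iff (hψ : IsRecessionMap φ ψ) (hφ : IsSubhomogeneous φ) (k : ℕ) :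
    ‖(fun X => ψ X + X)^[k] 1‖ < 2 ^ k ↔ ‖(Riccati.average ψ)^[k] 1‖ < 1 := by
  rw [hψ.add_id_iterate hφ posDef_one, norm_smul, Real.norm_of_nonneg (by positivity)]
  exact mul_lt_iff_lt_one_right (by positivity)

/-- The convergence `t⁻¹ F(tY) → F_∞(Y)` becomes an order bound with any factor above 1 because
`F_∞(Y)` is positive definite; monotonicity and subhomogeneity carry it through the iterates. -/
theorem eventually_iterate_average_le (hψ : IsRecessionMap φ ψ) (hφ : IsSubhomogeneous φ)
    (k : ℕ) : ∀ μ : ℝ, 1 < μ → ∀ᶠ t : ℝ in atTop,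
      (Riccati.average φ)^[k] (t • 1) ≤ (t * μ) • (Riccati.average ψ)^[k] 1 := by
  induction k with
  | zero =>
    intro μ hμ
    filter_upwards [eventually_ge_atTop 0] with t ht
    exact smul_one_le_smul_one (by nlinarith)
  | succ k ih =>
    intro μ hμ
    -- Half of the slack `μ = ν * ν` goes to the induction hypothesis, half to the limit at `Y`.
    obtain ⟨ν, hν1, hνμ⟩ : ∃ ν : ℝ, 1 < ν ∧ ν * ν = μ :=
      ⟨√μ, by rw [Real.lt_sqrt] <;> linarith, Real.mul_self_sqrt (by linarith)⟩
    set Y := (Riccati.average ψ)^[k] (1 : Matrix (Fin n) (Fin n) ℂ) with hY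
    have hYp : Y.PosDef := hψ.average_iterate_posDef hφ posDef_one k
    have hZp : (Riccati.average ψ Y).PosDef := hψ.average_posDef hφ hYp
    have hFp : ∀ t : ℝ, 0 < t → (Riccati.average φ (t • Y)).PosDef := fun t ht =>
      hφ.average.posDef _ (posDef_smul hYp ht)
    have hev := eventually_le_of_tendsto (W := ν • Riccati.average ψ Y) (hψ.average Y hYp)
      hZp.isHermitian
      (by
        filter_upwards [eventually_gt_atTop 0] with t ht
        exact (posDef_smul (hFp t ht) (inv_pos.2 ht)).isHermitian)
      (by
        have : ν • Riccati.average ψ Y - Riccati.average ψ Y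
            = (ν - 1) • Riccati.average ψ Y := by rw [sub_smul, one_smul]
        rw [this]
        exact posDef_smul hZp (by linarith))
    filter_upwards [ih ν hν1, hev, eventually_gt_atTop 0] with t h1 h2 ht
    rw [Function.iterate_succ_apply', Function.iterate_succ_apply', ← hY]
    have h3 : Riccati.average φ (t • Y) ≤ (t * ν) • Riccati.average ψ Y := by
      have := smul_le_smul_of_nonneg_left h2 ht.le
      rwa [smul_smul, smul_smul, mul_inv_cancel₀ ht.ne', one_smul] at this
    calc Riccati.average φ ((Riccati.average φ)^[k] (t • 1))
        ≤ Riccati.average φ ((t * ν) • Y) :=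
          hφ.average.mono _ _ ((hφ.average.iterate k).posDef _ (posDef_smul posDef_one ht)) h1
      _ = Riccati.average φ (ν • t • Y) := by rw [smul_smul, mul_comm]
      _ ≤ ν • Riccati.average φ (t • Y) :=
          hφ.average.map_smul_le _ _ (posDef_smul hYp ht) hν1.le
      _ ≤ ν • (t * ν) • Riccati.average ψ Y := smul_le_smul_of_nonneg_left h3 (by linarith)
      _ = _ := by rw [smul_smul, ← hνμ]; congr 1; ring

theorem exists_eventually_iterate_average_le (hψ : IsRecessionMap φ ψ) (hφ : IsSubhomogeneous φ)
    {k : ℕ} (hk : ‖(fun X => ψ X + X)^[k] (1 : Matrix (Fin n) (Fin n) ℂ)‖ < 2 ^ k) :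
    ∃ r : ℝ, 0 < r ∧ r < 1 ∧ ∀ᶠ t : ℝ in atTop,
      (Riccati.average φ)^[k] (t • 1) ≤ (t * r) • (1 : Matrix (Fin n) (Fin n) ℂ) := by
  rw [hψ.norm_add_id_iterate_lt_iff hφ] at hk
  set Y := (Riccati.average ψ)^[k] (1 : Matrix (Fin n) (Fin n) ℂ) with hY
  obtain ⟨q, hq1, hq2⟩ := exists_between hk
  have hq0 : 0 < q := (norm_nonneg _).trans_lt hq1
  -- The slack `μ` is small enough that `r = μ * q` stays below 1.
  obtain ⟨μ, hμ1, hμ2⟩ := exists_between ((one_lt_inv₀ hq0).2 hq2)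
  refine ⟨μ * q, by positivity, by rwa [lt_inv_comm₀ (by linarith) hq0, ← one_div, lt_div_iff₀' (by linarith)]
    at hμ2, ?_⟩
  filter_upwards [hψ.eventually_iterate_average_le hφ k μ hμ1, eventually_gt_atTop 0] with t h ht
  refine h.trans ?_
  have h1 : Y ≤ q • 1 :=
    (le_norm_smul_one (hψ.average_iterate_posDef hφ posDef_one k).isHermitian).trans
      (smul_one_le_smul_one hq1.le)
  have h2 := smul_le_smul_of_nonneg_left h1 (show 0 ≤ t * μ by positivity)
  rwa [smul_smul, mul_assoc] at h2

end IsRecessionMap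

end

/-! ### Bounded fixed points, supersolutions and necessity of the growth condition -/

section

open scoped MatrixOrder

variable {n : ℕ} {φ ψ : Matrix (Fin n) (Fin n) ℂ → Matrix (Fin n) (Fin n) ℂ}

namespace IsRecessionMap

/-- A fixed point satisfies `X = F^k(X) ≤ F^k(‖X‖ I) ≤ r‖X‖ I` once `‖X‖` is large, which
contradicts `r < 1`. -/
theorem exists_norm_le_of_fixed (hψ : IsRecessionMap φ ψ) (hφ : IsSubhomogeneous φ)
    {k : ℕ} (hk : ‖(fun X => ψ X + X)^[k] (1 : Matrix (Fin n) (Fin n) ℂ)‖ < 2 ^ k) :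
    ∃ T : ℝ, ∀ X : Matrix (Fin n) (Fin n) ℂ, X.PosDef → φ X = X → ‖X‖ ≤ T := by
  obtain ⟨r, hr0, hr1, hev⟩ := hψ.exists_eventually_iterate_average_le hφ hk
  obtain ⟨T, hT⟩ := eventually_atTop.1 hev
  refine ⟨max T 0, fun X hX hfix => ?_⟩
  by_contra! hlt
  have hpos : 0 < ‖X‖ := (le_max_right _ _).trans_lt hlt
  have h1 : X ≤ (‖X‖ * r) • 1 := by
    calc X = (Riccati.average φ)^[k] X :=
          (Function.iterate_fixed (average_eq_self_iff.2 hfix) k).symm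
      _ ≤ (Riccati.average φ)^[k] (‖X‖ • 1) :=
          (hφ.average.iterate k).mono _ _ hX (le_norm_smul_one hX.isHermitian)
      _ ≤ _ := hT _ ((le_max_left _ _).trans hlt.le)
  have h2 := norm_le_of_le_smul_one hX.posSemidef.nonneg (by positivity) h1
  nlinarith

end IsRecessionMap

namespace IsSubhomogeneous

theorem one_le_average_add (hφ : IsSubhomogeneous φ) {X : Matrix (Fin n) (Fin n) ℂ}
    (hX : X.PosDef) :
    1 ≤ Riccati.average (fun Y => φ Y + (2 : ℝ) • (1 : Matrix (Fin n) (Fin n) ℂ)) X := by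
  have h : (1 : Matrix (Fin n) (Fin n) ℂ) = (1 / 2 : ℝ) • ((2 : ℝ) • 1) := by
    rw [smul_smul]; norm_num
  unfold Riccati.average
  conv_lhs => rw [h]
  refine smul_le_smul_of_nonneg_left ?_ (by norm_num)
  have h1 := add_nonneg (hφ.posDef X hX).posSemidef.nonneg hX.posSemidef.nonneg
  calc (2 : ℝ) • (1 : Matrix (Fin n) (Fin n) ℂ) ≤ (2 : ℝ) • 1 + (φ X + X) :=
        le_add_of_nonneg_right h1
    _ = _ := by beta_reduce; abel

/-- The added constant `2I`, halved by averaging, does not scale with `β`. This makes subhomogeneity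
strict with a quantitative gap, which is what forces uniqueness. -/
theorem average_add_smul_le (hφ : IsSubhomogeneous φ) {X : Matrix (Fin n) (Fin n) ℂ}
    (hX : X.PosDef) {β : ℝ} (hβ : 1 ≤ β) :
    Riccati.average (fun Y => φ Y + (2 : ℝ) • (1 : Matrix (Fin n) (Fin n) ℂ)) (β • X) ≤
      β • Riccati.average (fun Y => φ Y + (2 : ℝ) • (1 : Matrix (Fin n) (Fin n) ℂ)) X
        - (β - 1) • 1 := by
  have h : β • Riccati.average (fun Y => φ Y + (2 : ℝ) • (1 : Matrix (Fin n) (Fin n) ℂ)) X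
      - (β - 1) • 1 = (1 / 2 : ℝ) • (β • φ X + (2 : ℝ) • 1 + β • X) := by
    unfold Riccati.average
    module
  rw [h]
  unfold Riccati.average
  exact smul_le_smul_of_nonneg_left
    (add_le_add_left (add_le_add_left (hφ.map_smul_le X β hX hβ) _) _) (by norm_num)

theorem iterate_average_add_smul_le (hφ : IsSubhomogeneous φ) {X : Matrix (Fin n) (Fin n) ℂ}
    (hX : X.PosDef) {β : ℝ} (hβ : 1 ≤ β) (k : ℕ) :
    (Riccati.average fun Y => φ Y + (2 : ℝ) • (1 : Matrix (Fin n) (Fin n) ℂ))^[k + 1] (β • X) ≤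
      β • (Riccati.average fun Y => φ Y + (2 : ℝ) • (1 : Matrix (Fin n) (Fin n) ℂ))^[k + 1] X
        - (β - 1) • 1 := by
  have hF := (hφ.add_smul_one two_pos).average
  rw [Function.iterate_succ_apply', Function.iterate_succ_apply']
  refine (hF.mono _ _ ((hF.iterate k).posDef _ (posDef_smul hX (by linarith)))
    ((hF.iterate k).map_smul_le X β hX hβ)).trans ?_
  exact hφ.average_add_smul_le ((hF.iterate k).posDef _ hX) hβ

/-- If `U ≤ (1 + γ)V`, applying the iterate to both sides gains `γI ≥ γ v⁻¹ V`, so the excess `γ`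
shrinks by the factor `1 - v⁻¹`. Repetition sends it to 0. -/
theorem fixed_le_fixed_of_iterate_average_add (hφ : IsSubhomogeneous φ) (k : ℕ)
    {U V : Matrix (Fin n) (Fin n) ℂ} (hU : U.PosDef) (hV : V.PosDef)
    (hUfix : (Riccati.average fun Y => φ Y + (2 : ℝ) • (1 : Matrix (Fin n) (Fin n) ℂ))^[k + 1] U
      = U)
    (hVfix : (Riccati.average fun Y => φ Y + (2 : ℝ) • (1 : Matrix (Fin n) (Fin n) ℂ))^[k + 1] V
      = V) : U ≤ V := by
  have hF := (hφ.add_smul_one two_pos).average.iterate (k + 1)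
  obtain ⟨β, hβ, hUβ⟩ := exists_one_le_and_le_smul hU hV
  obtain ⟨v, hv, hVv⟩ := exists_one_le_and_le_smul hV posDef_one
  have hv0 : 0 < v := by linarith
  have hc1 : v⁻¹ ≤ 1 := inv_le_one_of_one_le₀ hv
  have hc0 : 0 < v⁻¹ := inv_pos.2 hv0
  have hcV : v⁻¹ • V ≤ 1 := by
    have := smul_le_smul_of_nonneg_left hVv hc0.le
    rwa [smul_smul, inv_mul_cancel₀ hv0.ne', one_smul] at this
  have hstep : ∀ j : ℕ, U ≤ (1 + (β - 1) * (1 - v⁻¹) ^ j) • V := fun j => by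
    induction j with
    | zero => simpa using hUβ
    | succ j ih =>
      have hq : 0 ≤ (β - 1) * (1 - v⁻¹) ^ j :=
        mul_nonneg (by linarith) (pow_nonneg (by linarith) j)
      set γ := (β - 1) * (1 - v⁻¹) ^ j with hγ
      calc U = _ := hUfix.symm
        _ ≤ _ := hF.mono _ _ hU ih
        _ ≤ _ := hφ.iterate_average_add_smul_le hV (by linarith) k
        _ = (1 + γ) • V - γ • 1 := by rw [hVfix]; congr 2; ring
        _ ≤ (1 + γ) • V - γ • v⁻¹ • V :=
            sub_le_sub_left (smul_le_smul_of_nonneg_left hcV hq) _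
        _ = _ := by rw [smul_smul, ← sub_smul, pow_succ, ← mul_assoc, ← hγ]; congr 1; ring
  have hlim : Tendsto (fun j : ℕ => (1 + (β - 1) * (1 - v⁻¹) ^ j) • V) atTop
      (𝓝 ((1 + (β - 1) * 0) • V)) :=
    (((tendsto_pow_atTop_nhds_zero_of_lt_one (by linarith) (by linarith)).const_mul _).const_add
      1).smul_const V
  have := ge_of_tendsto' hlim hstep
  simpa using this

end IsSubhomogeneous

namespace IsRecessionMap

/-- The growth condition on the recession map yields a positive definite supersolution. -/
theorem exists_map_le (hψ : IsRecessionMap φ ψ) (hφ : IsSubhomogeneous φ) {k : ℕ} (hk0 : 0 < k)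
    (hk : ‖(fun X => ψ X + X)^[k] (1 : Matrix (Fin n) (Fin n) ℂ)‖ < 2 ^ k) :
    ∃ V : Matrix (Fin n) (Fin n) ℂ, V.PosDef ∧ φ V ≤ V := by
  -- At least one application of `F` is needed, since its outermost copy supplies both `1 ≤ F^k(1)`
  -- and the strict gap.
  obtain ⟨j, rfl⟩ := Nat.exists_eq_add_of_lt hk0
  rw [zero_add] at hk
  have hε := hφ.add_smul_one two_pos
  have hF := hε.average
  obtain ⟨r, hr0, hr1, hev⟩ :=
    (hψ.add_const ((2 : ℝ) • 1)).exists_eventually_iterate_average_le hε hk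
  obtain ⟨t, ht, ht1⟩ := (hev.and (eventually_ge_atTop 1)).exists
  obtain ⟨U, hU, -, hfix, -⟩ := (hF.iterate (j + 1)).exists_tendsto_of_map_le
    (Y := t • 1) (Z := 1) posDef_one
    (by simpa using smul_one_le_smul_one (n := n) ht1)
    (ht.trans (smul_one_le_smul_one (by nlinarith)))
    (by
      rw [Function.iterate_succ_apply']
      exact hφ.one_le_average_add ((hF.iterate j).posDef _ posDef_one))
  have hFU := hF.posDef U hU
  -- `U` is so far fixed only by `F^(j+1)`. Then `F U` is fixed by it as well, and uniqueness gives
  -- `F U = U`.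
  have hfix2 : (Riccati.average fun Y => φ Y + (2 : ℝ) • (1 : Matrix (Fin n) (Fin n) ℂ))^[j + 1]
      (Riccati.average (fun Y => φ Y + (2 : ℝ) • (1 : Matrix (Fin n) (Fin n) ℂ)) U)
      = Riccati.average (fun Y => φ Y + (2 : ℝ) • (1 : Matrix (Fin n) (Fin n) ℂ)) U := by
    rw [← Function.iterate_succ_apply, Function.iterate_succ_apply', hfix]
  have hFfix := le_antisymm (hφ.fixed_le_fixed_of_iterate_average_add j hFU hU hfix2 hfix)
    (hφ.fixed_le_fixed_of_iterate_average_add j hU hFU hfix hfix2)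
  rw [average_eq_self_iff] at hFfix
  refine ⟨U, hU, ?_⟩
  conv_rhs => rw [← hFfix]
  exact le_add_of_nonneg_right (posDef_smul posDef_one two_pos).posSemidef.nonneg

theorem average_iterate_le (hψ : IsRecessionMap φ ψ) (hφ : IsSubhomogeneous φ)
    {X : Matrix (Fin n) (Fin n) ℂ} (hX : X.PosDef) (k : ℕ) :
    (Riccati.average ψ)^[k] X ≤ (Riccati.average φ)^[k] X := by
  induction k with
  | zero => exact le_rfl
  | succ k ih =>
    rw [Function.iterate_succ_apply', Function.iterate_succ_apply']
    have hp := hψ.average_iterate_posDef hφ hX k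
    exact (hψ.average.le hφ.average hp).trans (hφ.average.mono _ _ hp ih)

theorem average_iterate_smul (hψ : IsRecessionMap φ ψ) (hφ : IsSubhomogeneous φ)
    {X : Matrix (Fin n) (Fin n) ℂ} (hX : X.PosDef) {t : ℝ} (ht : 0 < t) (k : ℕ) :
    (Riccati.average ψ)^[k] (t • X) = t • (Riccati.average ψ)^[k] X := by
  induction k with
  | zero => rfl
  | succ k ih =>
    rw [Function.iterate_succ_apply', Function.iterate_succ_apply', ih,
      hψ.average.map_smul (hψ.average_iterate_posDef hφ hX k) ht]

/-- A unique positive definite fixed point forces the growth condition on the recession map. -/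
theorem exists_norm_add_id_iterate_lt (hψ : IsRecessionMap φ ψ) (hφ : IsSubhomogeneous φ)
    {U : Matrix (Fin n) (Fin n) ℂ} (hU : U.PosDef) (hfix : φ U = U)
    (huniq : ∀ V : Matrix (Fin n) (Fin n) ℂ, V.PosDef → φ V = V → V = U) :
    ∃ k : ℕ, 0 < k ∧ ‖(fun X => ψ X + X)^[k] (1 : Matrix (Fin n) (Fin n) ℂ)‖ < 2 ^ k := by
  have hattr := hφ.average.isGloballyAttractingFixedPoint hU (average_eq_self_iff.2 hfix)
    fun V hV h => huniq V hV (average_eq_self_iff.1 h)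
  -- Start the orbit strictly above the norm of its limit, so that its norm eventually drops below
  -- the starting multiple of the identity.
  have ht : 0 < ‖U‖ + 1 := by positivity
  have htp : ((‖U‖ + 1) • (1 : Matrix (Fin n) (Fin n) ℂ)).PosDef := posDef_smul posDef_one ht
  obtain ⟨k, hk, hk0⟩ := (((hattr.2.2 _ htp).norm.eventually_lt_const
    (lt_add_one ‖U‖)).and (eventually_gt_atTop 0)).exists
  refine ⟨k, hk0, ?_⟩
  rw [hψ.norm_add_id_iterate_lt_iff hφ]
  have h1 := CStarAlgebra.norm_le_norm_of_nonneg_of_le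
    (hψ.average_iterate_posDef hφ htp k).posSemidef.nonneg (hψ.average_iterate_le hφ htp k)
  have h2 := h1.trans_lt hk
  rw [hψ.average_iterate_smul hφ posDef_one ht, norm_smul, Real.norm_of_nonneg ht.le] at h2
  exact (mul_lt_iff_lt_one_right ht).1 h2

end IsRecessionMap

end

section

open scoped MatrixOrder

variable {n : ℕ}

/-! ### Projections onto nullspaces -/

theorem isStarProjection_nullProj (A : Matrix (Fin n) (Fin n) ℂ) :
    IsStarProjection (nullProj A) := by
  have h : IsStarProjection (LinearMap.ker (Matrix.toEuclideanLin A)).starProjection :=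
    isStarProjection_starProjection
  refine ⟨?_, ?_⟩
  · rw [IsIdempotentElem, nullProj, ← map_mul, h.isIdempotentElem]
  · exact ((Matrix.toEuclideanCLM (n := Fin n) (𝕜 := ℂ)).symm.map_star' _).symm.trans
      (congrArg _ h.isSelfAdjoint.star_eq)

theorem nullProj_conjTranspose (A : Matrix (Fin n) (Fin n) ℂ) : (nullProj A)ᴴ = nullProj A :=
  (isStarProjection_nullProj A).isSelfAdjoint

theorem nullProj_mul_self (A : Matrix (Fin n) (Fin n) ℂ) :
    nullProj A * nullProj A = nullProj A :=
  (isStarProjection_nullProj A).isIdempotentElem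

theorem toEuclideanCLM_nullProj (A : Matrix (Fin n) (Fin n) ℂ) :
    Matrix.toEuclideanCLM (n := Fin n) (𝕜 := ℂ) (nullProj A) =
      (LinearMap.ker (Matrix.toEuclideanLin A)).starProjection :=
  StarAlgEquiv.apply_symm_apply _ _

theorem mul_nullProj (A : Matrix (Fin n) (Fin n) ℂ) : A * nullProj A = 0 := by
  apply EquivLike.injective (Matrix.toEuclideanCLM (n := Fin n) (𝕜 := ℂ))
  rw [map_mul, map_zero, toEuclideanCLM_nullProj]
  ext1 x
  exact LinearMap.mem_ker.1
    (Submodule.starProjection_apply_mem (LinearMap.ker (Matrix.toEuclideanLin A)) x)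

theorem nullProj_mul_eq_self {A M : Matrix (Fin n) (Fin n) ℂ} (h : A * M = 0) :
    nullProj A * M = M := by
  apply EquivLike.injective (Matrix.toEuclideanCLM (n := Fin n) (𝕜 := ℂ))
  rw [map_mul, toEuclideanCLM_nullProj]
  ext1 x
  refine Submodule.starProjection_eq_self_iff.2 (LinearMap.mem_ker.2 ?_)
  have h2 : Matrix.toEuclideanCLM (n := Fin n) (𝕜 := ℂ) (A * M) x = 0 := by rw [h]; simp
  rwa [map_mul] at h2

theorem nullProj_mul {A : Matrix (Fin n) (Fin n) ℂ} (hA : A.IsHermitian) :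
    nullProj A * A = 0 := by
  have := congrArg conjTranspose (mul_nullProj A)
  rwa [conjTranspose_mul, nullProj_conjTranspose, hA.eq, conjTranspose_zero] at this

theorem one_sub_nullProj {A : Matrix (Fin n) (Fin n) ℂ} (hA : A.IsHermitian) :
    1 - nullProj A = A * pinv A := by
  have hP := isMoorePenrose_pinv A
  have h1 : A * (1 - A * pinv A) = 0 := by
    have := congrArg conjTranspose (show (1 - A * pinv A) * A = 0 by
      rw [sub_mul, one_mul, hP.mul_mul_left, sub_self])
    rwa [conjTranspose_mul, conjTranspose_sub, conjTranspose_one, hP.isHermitian_left.eq, hA.eq,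
      conjTranspose_zero] at this
  have h2 := nullProj_mul_eq_self h1
  rw [mul_sub, ← mul_assoc, nullProj_mul hA, zero_mul, mul_one, sub_zero] at h2
  rw [h2, sub_sub_cancel]

/-- The hypothesis gives `(QZ)* S (QZ) = 0`, and `S` is bounded below by a positive multiple of the
identity. -/
theorem mul_eq_zero_of_compression_mul_eq_zero {S Q Z : Matrix (Fin n) (Fin n) ℂ}
    (hS : S.PosDef) (hQ : Qᴴ = Q) (h : Q * S * Q * Z = 0) : Q * Z = 0 := by
  obtain ⟨c, hc, hcS⟩ := exists_smul_one_le hS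
  have h1 := star_left_conjugate_le_conjugate hcS (Q * Z)
  have h2 : star (Q * Z) * S * (Q * Z) = 0 := by
    rw [star_eq_conjTranspose, conjTranspose_mul, hQ]
    calc Zᴴ * Q * S * (Q * Z) = Zᴴ * (Q * S * Q * Z) := by simp only [mul_assoc]
      _ = 0 := by rw [h, mul_zero]
  rw [h2, mul_smul_comm, mul_one, smul_mul_assoc] at h1
  have h3 : star (Q * Z) * (Q * Z) ≤ 0 := by
    have := smul_le_smul_of_nonneg_left h1 (inv_pos.2 hc).le
    rwa [smul_smul, inv_mul_cancel₀ hc.ne', one_smul, smul_zero] at this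
  exact conjTranspose_mul_self_eq_zero.1 (le_antisymm h3 (star_mul_self_nonneg (Q * Z)))

/-- On the range of `Q` the compression `QSQ` is injective, so its pseudoinverse is a genuine
inverse there. -/
theorem pinv_compression {S Q : Matrix (Fin n) (Fin n) ℂ} (hS : S.PosDef) (hQ : Qᴴ = Q)
    (hQQ : Q * Q = Q) : Q * pinv (Q * S * Q) = pinv (Q * S * Q) ∧
      Q * S * pinv (Q * S * Q) = Q := by
  have hP := isMoorePenrose_pinv (Q * S * Q)
  set P := pinv (Q * S * Q)
  set M := Q * S * Q with hM
  have hMQ : M * Q = M := by rw [hM, mul_assoc, hQQ]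
  have hQM : Q * M = M := by rw [hM, ← mul_assoc, ← mul_assoc, hQQ]
  have hMh : Mᴴ = M := by
    rw [hM, conjTranspose_mul, conjTranspose_mul, hQ, hS.isHermitian.eq, mul_assoc]
  have h1 : Q * (P * M) = P * M := by
    have : ((P * M) * Q)ᴴ = (P * M)ᴴ := by rw [mul_assoc, hMQ]
    rwa [conjTranspose_mul, hP.isHermitian_right.eq, hQ] at this
  have h2 : Q * P = P := by
    calc Q * P = Q * (P * M * P) := by rw [hP.mul_mul_right]
      _ = Q * (P * M) * P := by simp only [mul_assoc]
      _ = P := by rw [h1, hP.mul_mul_right]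
  refine ⟨h2, ?_⟩
  have h3 : M * (1 - M * P) = 0 := by
    have := congrArg conjTranspose (show (1 - M * P) * M = 0 by
      rw [sub_mul, one_mul, hP.mul_mul_left, sub_self])
    rwa [conjTranspose_mul, conjTranspose_sub, conjTranspose_one, hP.isHermitian_left.eq, hMh,
      conjTranspose_zero] at this
  have h4 := mul_eq_zero_of_compression_mul_eq_zero hS hQ h3
  rw [mul_sub, mul_one, ← mul_assoc, hQM, sub_eq_zero] at h4
  conv_lhs => rw [← h2]
  rw [← mul_assoc, ← hM, ← h4]

/-- As the multiple of `B` grows, the inverse of `τ B + S` tends to the pseudoinverse of the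
compression of `S` to the nullspace of `B`. -/
theorem tendsto_inv_smul_add {ι : Type*} {l : Filter ι} {B S₀ : Matrix (Fin n) (Fin n) ℂ}
    (hB : B.PosSemidef) (hS₀ : S₀.PosDef) {τ : ι → ℝ} (hτ : Tendsto τ l atTop)
    {S : ι → Matrix (Fin n) (Fin n) ℂ} (hS : ∀ᶠ i in l, (S i).PosDef)
    (hlim : Tendsto S l (𝓝 S₀)) :
    Tendsto (fun i => (τ i • B + S i)⁻¹) l (𝓝 (pinv (nullProj B * S₀ * nullProj B))) := by
  obtain ⟨hQP, hQSP⟩ :=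
    pinv_compression hS₀ (nullProj_conjTranspose B) (nullProj_mul_self B)
  set P := pinv (nullProj B * S₀ * nullProj B)
  have hBP : B * P = 0 := by rw [← hQP, ← mul_assoc, mul_nullProj, zero_mul]
  -- `1 - S₀ P` is annihilated by the null projection, hence factors through `B`; this factor is
  -- what the large multiple of `B` absorbs.
  have hres : 1 - S₀ * P = B * pinv B * (1 - S₀ * P) := by
    rw [← one_sub_nullProj hB.isHermitian, sub_mul, one_mul, mul_sub, mul_one, ← mul_assoc, hQSP,
      sub_self, sub_zero]
  set G := pinv B * (1 - S₀ * P) with hG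
  have hinv : Tendsto (fun i => (S i)⁻¹) l (𝓝 S₀⁻¹) :=
    (continuousAt_inv_of_posDef hS₀).tendsto.comp hlim
  have hbound : ∀ᶠ i in l, ‖(τ i • B + S i)⁻¹ - P‖ ≤
      (τ i)⁻¹ * ((‖(1 : Matrix (Fin n) (Fin n) ℂ)‖ + ‖(S i)⁻¹‖ * ‖S i‖) * ‖G‖)
        + ‖(S i)⁻¹‖ * ‖S₀ - S i‖ * ‖P‖ := by
    filter_upwards [hS, hτ.eventually_gt_atTop 0] with i hi hτi
    have hτB : 0 ≤ τ i • B := smul_nonneg hτi.le hB.nonneg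
    have hle : S i ≤ τ i • B + S i := le_add_of_nonneg_left hτB
    have hp := posDef_of_le hi hle
    set R := (τ i • B + S i)⁻¹ with hR
    have hRn : ‖R‖ ≤ ‖(S i)⁻¹‖ := CStarAlgebra.norm_le_norm_of_nonneg_of_le
      hp.inv.posSemidef.nonneg (inv_le_inv_of_posDef hi hle)
    have hR1 : R * (τ i • B + S i) = 1 := inv_mul_of_posDef hp
    have hRB : R * B = (τ i)⁻¹ • (1 - R * S i) := by
      rw [mul_add, mul_smul_comm] at hR1
      rw [← hR1, add_sub_cancel_right, smul_smul, inv_mul_cancel₀ hτi.ne', one_smul]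
    -- In the first term `R * B` is of order `(τ i)⁻¹`; in the second `S₀ - S i` tends to 0. The
    -- bound `R ≤ (S i)⁻¹` controls `R` in both.
    have key : R - P = (τ i)⁻¹ • ((1 - R * S i) * G) + R * (S₀ - S i) * P := by
      calc R - P = R * (1 - (τ i • B + S i) * P) := by
            rw [mul_sub, mul_one, ← mul_assoc, hR1, one_mul]
        _ = R * ((1 - S₀ * P) + (S₀ - S i) * P) := by
            rw [add_mul, smul_mul_assoc, hBP, smul_zero, zero_add, sub_mul]
            congr 1
            abel
        _ = R * B * G + R * (S₀ - S i) * P := by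
            rw [mul_add, hres, hG]
            simp only [mul_assoc]
        _ = _ := by rw [hRB, smul_mul_assoc]
    rw [key]
    refine (norm_add_le _ _).trans (add_le_add ?_ ?_)
    · rw [norm_smul, Real.norm_of_nonneg (inv_pos.2 hτi).le]
      refine mul_le_mul_of_nonneg_left ((norm_mul_le _ _).trans ?_) (inv_pos.2 hτi).le
      refine mul_le_mul_of_nonneg_right ((norm_sub_le _ _).trans ?_) (norm_nonneg _)
      gcongr
      exact (norm_mul_le _ _).trans (mul_le_mul_of_nonneg_right hRn (norm_nonneg _))
    · refine (norm_mul_le _ _).trans (mul_le_mul_of_nonneg_right ?_ (norm_nonneg _))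
      exact (norm_mul_le _ _).trans (mul_le_mul_of_nonneg_right hRn (norm_nonneg _))
  rw [tendsto_iff_norm_sub_tendsto_zero]
  refine squeeze_zero' (Eventually.of_forall fun i => norm_nonneg _) hbound ?_
  have h1 := (tendsto_inv_atTop_zero.comp hτ).mul
    (((hinv.norm.mul hlim.norm).const_add ‖(1 : Matrix (Fin n) (Fin n) ℂ)‖).mul_const ‖G‖)
  have h2 := (hinv.norm.mul (hlim.const_sub S₀).norm).mul_const ‖P‖
  have h3 := h1.add h2
  rw [zero_mul, sub_self, norm_zero, mul_zero, zero_mul, add_zero] at h3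
  exact h3

end

section

open scoped MatrixOrder

variable {n : ℕ} {φ : Matrix (Fin n) (Fin n) ℂ → Matrix (Fin n) (Fin n) ℂ}

/-! ### Conjugation by the inversion -/

theorem invConj_inv {X : Matrix (Fin n) (Fin n) ℂ} (hX : X.PosDef) :
    invConj φ X⁻¹ = (φ X)⁻¹ := by
  rw [invConj, inv_inv_of_posDef hX]

theorem IsSubhomogeneous.invConj (hφ : IsSubhomogeneous φ) : IsSubhomogeneous (invConj φ) where
  posDef X hX := (hφ.posDef _ hX.inv).inv
  mono X Y hX h := inv_le_inv_of_posDef (hφ.posDef _ (posDef_of_le hX h).inv)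
    (hφ.mono _ _ (posDef_of_le hX h).inv (inv_le_inv_of_posDef hX h))
  map_smul_le X t hX ht := by
    have ht0 : 0 < t := by linarith
    have h := hφ.le_map_smul hX.inv (inv_pos.2 ht0) (inv_le_one_of_one_le₀ ht)
    have h2 := inv_le_inv_of_posDef (posDef_smul (hφ.posDef _ hX.inv) (inv_pos.2 ht0)) h
    rw [inv_real_smul _ (inv_pos.2 ht0).ne', inv_inv] at h2
    rwa [Riccati.invConj, inv_real_smul _ ht0.ne']
  continuousAt X hX := by
    have h1 : ContinuousAt (fun Y : Matrix (Fin n) (Fin n) ℂ => φ Y⁻¹) X :=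
      ContinuousAt.comp (f := fun Y : Matrix (Fin n) (Fin n) ℂ => Y⁻¹)
        (hφ.continuousAt _ hX.inv) (continuousAt_inv_of_posDef hX)
    exact ContinuousAt.comp (f := fun Y : Matrix (Fin n) (Fin n) ℂ => φ Y⁻¹)
      (g := fun Y : Matrix (Fin n) (Fin n) ℂ => Y⁻¹)
      (continuousAt_inv_of_posDef (hφ.posDef _ hX.inv)) h1

/-! ### The Riccati map -/

variable {A B N : Matrix (Fin n) (Fin n) ℂ}

theorem conj_le_conj {X Y : Matrix (Fin n) (Fin n) ℂ} (h : X ≤ Y)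
    (N : Matrix (Fin n) (Fin n) ℂ) : Nᴴ * X * N ≤ Nᴴ * Y * N :=
  star_left_conjugate_le_conjugate h N

theorem posDef_add_conj (hA : A.PosSemidef) (hAN : (A + Nᴴ * N).PosDef)
    {C : Matrix (Fin n) (Fin n) ℂ} (hC : C.PosDef) : (A + Nᴴ * C * N).PosDef := by
  obtain ⟨c, hc, h⟩ := exists_smul_one_le hC
  -- The minimum with 1 lets a single multiple of `A + N* N` lie below both summands.
  have hd : 0 < min c 1 := lt_min hc one_pos
  refine posDef_of_le (posDef_smul hAN hd) ?_
  rw [smul_add]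
  refine add_le_add ?_ ?_
  · have := smul_le_smul_of_nonneg_right (min_le_right c 1) hA.nonneg
    rwa [one_smul] at this
  · have := conj_le_conj ((smul_one_le_smul_one (min_le_left c 1)).trans h) N
    rwa [mul_smul_comm, smul_mul_assoc, mul_one] at this

theorem posDef_add_inv (hB : B.PosSemidef) {X : Matrix (Fin n) (Fin n) ℂ} (hX : X.PosDef) :
    (B + X⁻¹).PosDef :=
  hX.inv.posSemidef_add hB

theorem isSubhomogeneous_riccatiMap (hA : A.PosSemidef) (hB : B.PosSemidef)
    (hAN : (A + Nᴴ * N).PosDef) : IsSubhomogeneous (riccatiMap A B N) where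
  posDef X hX := posDef_add_conj hA hAN (posDef_add_inv hB hX).inv
  mono X Y hX h := add_le_add_right (conj_le_conj (inv_le_inv_of_posDef
    (posDef_add_inv hB (posDef_of_le hX h))
    (add_le_add_right (inv_le_inv_of_posDef hX h) B)) N) A
  map_smul_le X t hX ht := by
    have ht0 : 0 < t := by linarith
    have hti := inv_pos.2 ht0
    unfold riccatiMap
    rw [smul_add]
    refine add_le_add ?_ ?_
    · have := smul_le_smul_of_nonneg_right ht hA.nonneg
      rwa [one_smul] at this
    · rw [← smul_mul_assoc, ← mul_smul_comm]
      refine conj_le_conj ?_ N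
      have h1 : t⁻¹ • (B + X⁻¹) ≤ B + (t • X)⁻¹ := by
        rw [inv_real_smul _ ht0.ne', smul_add]
        refine add_le_add_left ?_ _
        have := smul_le_smul_of_nonneg_right (inv_le_one_of_one_le₀ ht) hB.nonneg
        rwa [one_smul] at this
      have h2 := inv_le_inv_of_posDef (posDef_smul (posDef_add_inv hB hX) hti) h1
      rwa [inv_real_smul _ hti.ne', inv_inv] at h2
  continuousAt X hX := by
    have h1 : ContinuousAt (fun Y : Matrix (Fin n) (Fin n) ℂ => B + Y⁻¹) X :=
      (continuousAt_inv_of_posDef hX).const_add B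
    have h2 : ContinuousAt (fun Y : Matrix (Fin n) (Fin n) ℂ => (B + Y⁻¹)⁻¹) X :=
      ContinuousAt.comp (f := fun Y : Matrix (Fin n) (Fin n) ℂ => B + Y⁻¹)
        (g := fun Y : Matrix (Fin n) (Fin n) ℂ => Y⁻¹)
        (continuousAt_inv_of_posDef (posDef_add_inv hB hX)) h1
    exact ((h2.const_mul Nᴴ).mul_const N).const_add A

theorem isRecessionMap_recF (hB : B.PosSemidef) :
    IsRecessionMap (riccatiMap A B N) (recF B N) := fun X hX => by
  have h := tendsto_inv_smul_add (l := atTop) (τ := fun t : ℝ => t) (S := fun _ => X⁻¹) hB hX.inv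
    tendsto_id (Eventually.of_forall fun _ => hX.inv) tendsto_const_nhds
  have h2 := ((tendsto_inv_atTop_zero (𝕜 := ℝ)).smul_const A).add ((h.const_mul Nᴴ).mul_const N)
  rw [zero_smul, zero_add] at h2
  refine h2.congr' ?_
  filter_upwards [eventually_gt_atTop 0] with t ht
  have : t • B + X⁻¹ = t • (B + (t • X)⁻¹) := by
    rw [inv_real_smul _ ht.ne', smul_add, smul_smul, mul_inv_cancel₀ ht.ne', one_smul]
  rw [this, inv_real_smul _ ht.ne', riccatiMap, smul_add, mul_smul_comm, smul_mul_assoc]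

theorem isRecessionMap_recLFL (hA : A.PosSemidef) (hB : B.PosSemidef)
    (hAN : (A + Nᴴ * N).PosDef) :
    IsRecessionMap (invConj (riccatiMap A B N)) (recLFL A N) := fun X hX => by
  have hS₀ : (A + Nᴴ * X⁻¹ * N).PosDef := posDef_add_conj hA hAN hX.inv
  have hin : Tendsto (fun t : ℝ => t⁻¹ • B + X) atTop (𝓝 X) := by
    have := ((tendsto_inv_atTop_zero (𝕜 := ℝ)).smul_const B).add_const X
    rwa [zero_smul, zero_add] at this
  have hinp : ∀ t : ℝ, 0 < t → (t⁻¹ • B + X).PosDef := fun t ht =>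
    hX.posSemidef_add (smul_nonneg (inv_pos.2 ht).le hB.nonneg).posSemidef
  have hlim : Tendsto (fun t : ℝ => A + Nᴴ * (t⁻¹ • B + X)⁻¹ * N) atTop
      (𝓝 (A + Nᴴ * X⁻¹ * N)) :=
    ((((continuousAt_inv_of_posDef hX).tendsto.comp hin).const_mul Nᴴ).mul_const N).const_add A
  have hp : ∀ᶠ t : ℝ in atTop, (A + Nᴴ * (t⁻¹ • B + X)⁻¹ * N).PosDef := by
    filter_upwards [eventually_gt_atTop 0] with t ht
    exact posDef_add_conj hA hAN (hinp t ht).inv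
  -- Split `tA = (t - 1)A + A`: `N* X⁻¹ N` alone may be singular, so one copy of `A` stays in the
  -- limit matrix. The null projection of `A` then removes it.
  have h := tendsto_inv_smul_add hA hS₀ (tendsto_atTop_add_const_right atTop (-1 : ℝ) tendsto_id)
    hp hlim
  have hQ : nullProj A * (A + Nᴴ * X⁻¹ * N) * nullProj A
      = nullProj A * Nᴴ * X⁻¹ * N * nullProj A := by
    rw [mul_add, nullProj_mul hA.isHermitian, zero_add]
    simp only [mul_assoc]
  rw [hQ] at h
  refine h.congr' ?_
  filter_upwards [eventually_gt_atTop 0] with t ht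
  have h1 : (t⁻¹ • B + X)⁻¹ = t • (B + t • X)⁻¹ := by
    have : t⁻¹ • B + X = t⁻¹ • (B + t • X) := by
      rw [smul_add, smul_smul, inv_mul_cancel₀ ht.ne', one_smul]
    rw [this, inv_real_smul _ (inv_pos.2 ht).ne', inv_inv]
  rw [invConj, ← inv_real_smul _ ht.ne', riccatiMap, inv_inv_of_posDef (posDef_smul hX ht), h1]
  congr 1
  simp only [id, mul_smul_comm, smul_mul_assoc, smul_add]
  module

end

section

open scoped MatrixOrder

variable {n : ℕ} {A B N : Matrix (Fin n) (Fin n) ℂ}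

/-! ### Uniqueness of fixed points -/

/-- The closed-loop matrix `X⁻¹ (B + X⁻¹)⁻¹ N = (1 + B X)⁻¹ N`. -/
noncomputable def closedLoop (B N X : Matrix (Fin n) (Fin n) ℂ) : Matrix (Fin n) (Fin n) ℂ :=
  X⁻¹ * (B + X⁻¹)⁻¹ * N

theorem inv_sub_inv_eq (hB : B.PosSemidef) {X Y : Matrix (Fin n) (Fin n) ℂ} (hX : X.PosDef)
    (hY : Y.PosDef) : (B + X⁻¹)⁻¹ - (B + Y⁻¹)⁻¹
      = (B + X⁻¹)⁻¹ * X⁻¹ * (X - Y) * (Y⁻¹ * (B + Y⁻¹)⁻¹) := by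
  have h1 := inv_mul_of_posDef (posDef_add_inv hB hX)
  have h2 := mul_inv_of_posDef (posDef_add_inv hB hY)
  have h3 : X⁻¹ * (X - Y) * Y⁻¹ = (B + Y⁻¹) - (B + X⁻¹) := by
    rw [mul_sub, inv_mul_of_posDef hX, sub_mul, one_mul, mul_assoc, mul_inv_of_posDef hY, mul_one]
    abel
  calc (B + X⁻¹)⁻¹ - (B + Y⁻¹)⁻¹
      = (B + X⁻¹)⁻¹ * ((B + Y⁻¹) * (B + Y⁻¹)⁻¹)
        - (B + X⁻¹)⁻¹ * (B + X⁻¹) * (B + Y⁻¹)⁻¹ := by rw [h1, h2, mul_one, one_mul]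
    _ = (B + X⁻¹)⁻¹ * (X⁻¹ * (X - Y) * Y⁻¹) * (B + Y⁻¹)⁻¹ := by rw [h3]; noncomm_ring
    _ = _ := by simp only [mul_assoc]

theorem closedLoop_conjTranspose (hB : B.PosSemidef) {X : Matrix (Fin n) (Fin n) ℂ}
    (hX : X.PosDef) : (closedLoop B N X)ᴴ = Nᴴ * ((B + X⁻¹)⁻¹ * X⁻¹) := by
  rw [closedLoop, conjTranspose_mul, conjTranspose_mul,
    (posDef_add_inv hB hX).inv.isHermitian.eq, hX.inv.isHermitian.eq]

/-- The resolvent identity places the closed loop of `X` on the left and that of `Y` on the right,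
so at two fixed points it can be iterated. -/
theorem riccatiMap_sub (hB : B.PosSemidef) {X Y : Matrix (Fin n) (Fin n) ℂ} (hX : X.PosDef)
    (hY : Y.PosDef) : riccatiMap A B N X - riccatiMap A B N Y
      = (closedLoop B N X)ᴴ * (X - Y) * closedLoop B N Y := by
  rw [closedLoop_conjTranspose hB hX, closedLoop, riccatiMap, riccatiMap, add_sub_add_left_eq_sub,
    ← sub_mul, ← mul_sub, inv_sub_inv_eq hB hX hY]
  simp only [mul_assoc]

theorem mul_closedLoop {X : Matrix (Fin n) (Fin n) ℂ} (hX : X.PosDef) :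
    X * closedLoop B N X = (B + X⁻¹)⁻¹ * N := by
  rw [closedLoop, mul_assoc X⁻¹, ← mul_assoc X, mul_inv_of_posDef hX, one_mul]

theorem riccatiMap_eq_closedLoop (hB : B.PosSemidef) {X : Matrix (Fin n) (Fin n) ℂ}
    (hX : X.PosDef) : riccatiMap A B N X
      = A + (X * closedLoop B N X)ᴴ * B * (X * closedLoop B N X)
        + (closedLoop B N X)ᴴ * X * closedLoop B N X := by
  have hp := posDef_add_inv hB hX
  have h1 : (B + X⁻¹)⁻¹ = (B + X⁻¹)⁻¹ * B * (B + X⁻¹)⁻¹ + (B + X⁻¹)⁻¹ * X⁻¹ * (B + X⁻¹)⁻¹ := by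
    rw [← add_mul, ← mul_add, inv_mul_of_posDef hp, one_mul]
  rw [mul_assoc _ X, mul_closedLoop hX, closedLoop_conjTranspose hB hX, conjTranspose_mul,
    hp.inv.isHermitian.eq, riccatiMap, add_assoc]
  congr 1
  conv_lhs => rw [h1]
  noncomm_ring

theorem closedLoop_conj_le (hA : A.PosSemidef) (hB : B.PosSemidef) {X : Matrix (Fin n) (Fin n) ℂ}
    (hX : X.PosDef) (hfix : riccatiMap A B N X = X) :
    (closedLoop B N X)ᴴ * X * closedLoop B N X ≤ X := by
  have h := riccatiMap_eq_closedLoop (A := A) (N := N) hB hX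
  rw [hfix] at h
  conv_rhs => rw [h]
  exact le_add_of_nonneg_left (add_nonneg hA.nonneg (hB.conjTranspose_mul_mul_same _).nonneg)

theorem pow_conj_le {Φ X : Matrix (Fin n) (Fin n) ℂ} (h : Φᴴ * X * Φ ≤ X) (j : ℕ) :
    (Φ ^ j)ᴴ * X * Φ ^ j ≤ X := by
  induction j with
  | zero => simp
  | succ j ih =>
    calc (Φ ^ (j + 1))ᴴ * X * Φ ^ (j + 1) = (Φ ^ j)ᴴ * (Φᴴ * X * Φ) * Φ ^ j := by
          rw [pow_succ', conjTranspose_mul]; simp only [mul_assoc]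
      _ ≤ _ := (conj_le_conj h _).trans ih

theorem exists_norm_pow_le {Φ X : Matrix (Fin n) (Fin n) ℂ} (hX : X.PosDef)
    (h : Φᴴ * X * Φ ≤ X) : ∃ K : ℝ, ∀ j : ℕ, ‖Φ ^ j‖ ≤ K := by
  obtain ⟨c, hc, hcX⟩ := exists_smul_one_le hX
  refine ⟨√(‖X‖ / c), fun j => Real.le_sqrt_of_sq_le ?_⟩
  rw [le_div_iff₀' hc]
  have h1 := (conj_le_conj hcX (Φ ^ j)).trans (pow_conj_le h j)
  rw [mul_smul_comm, mul_one, smul_mul_assoc] at h1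
  have h2 := CStarAlgebra.norm_le_norm_of_nonneg_of_le
    (smul_nonneg hc.le (star_mul_self_nonneg (Φ ^ j))) h1
  rwa [norm_smul, Real.norm_of_nonneg hc.le, CStarRing.norm_star_mul_self, ← sq] at h2

/-- Gelfand's formula: a spectral radius below `q < 1` gives `‖Φ ^ j‖ ≤ q ^ j` for large `j`. -/
theorem tendsto_pow_zero_of_spectrum [Nontrivial (Matrix (Fin n) (Fin n) ℂ)]
    {Φ : Matrix (Fin n) (Fin n) ℂ}
    (h : ∀ z ∈ spectrum ℂ Φ, ‖z‖ < 1) : Tendsto (fun j : ℕ => Φ ^ j) atTop (𝓝 0) := by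
  have h1 : spectralRadius ℂ Φ < 1 := by
    have := spectrum.spectralRadius_lt_of_forall_lt Φ (r := 1) fun z hz => by
      exact_mod_cast h z hz
    simpa using this
  obtain ⟨q, hq1, hq2⟩ := exists_between h1
  lift q to NNReal using (hq2.trans ENNReal.one_lt_top).ne
  have h2 := (spectrum.pow_nnnorm_pow_one_div_tendsto_nhds_spectralRadius Φ).eventually_lt_const hq1
  have hq : (q : ℝ) < 1 := by exact_mod_cast hq2
  refine squeeze_zero_norm' (a := fun j : ℕ => (q : ℝ) ^ j) ?_
    (tendsto_pow_atTop_nhds_zero_of_lt_one q.2 hq)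
  filter_upwards [h2, eventually_gt_atTop 0] with j hj hj0
  have hj' : (0 : ℝ) < j := by exact_mod_cast hj0
  rw [one_div, ENNReal.rpow_inv_lt_iff hj', ENNReal.rpow_natCast] at hj
  have : ‖Φ ^ j‖₊ < q ^ j := by exact_mod_cast hj
  exact_mod_cast this.le

/-- When `B * W = 0`, adding `W` to `U` adds exactly `W` to `(B + U⁻¹)⁻¹`, and conjugation by `N`
preserves `W`. -/
theorem riccatiMap_add_eq_self (hB : B.PosSemidef) {U W : Matrix (Fin n) (Fin n) ℂ}
    (hU : U.PosDef) (hfix : riccatiMap A B N U = U) (hW : W.PosSemidef) (hBW : B * W = 0)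
    (hNW : Nᴴ * W * N = W) : riccatiMap A B N (U + W) = U + W := by
  have hX : (U + W).PosDef := hU.add_posSemidef hW
  have hWB : W * B = 0 := by
    have := congrArg conjTranspose hBW
    rwa [conjTranspose_mul, hW.isHermitian.eq, hB.isHermitian.eq, conjTranspose_zero] at this
  have h1 : (B + (U + W)⁻¹)⁻¹ * (U + W)⁻¹ * W = W := by
    have : (B + (U + W)⁻¹)⁻¹ * (B + (U + W)⁻¹) * W = W := by
      rw [inv_mul_of_posDef (posDef_add_inv hB hX), one_mul]
    rwa [mul_assoc, add_mul, hBW, zero_add, ← mul_assoc] at this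
  have h2 : W * (U⁻¹ * (B + U⁻¹)⁻¹) = W := by
    have : W * ((B + U⁻¹) * (B + U⁻¹)⁻¹) = W := by
      rw [mul_inv_of_posDef (posDef_add_inv hB hU), mul_one]
    rwa [← mul_assoc, mul_add, hWB, zero_add, mul_assoc] at this
  have h3 := inv_sub_inv_eq hB hX hU
  rw [add_sub_cancel_left, h1, h2, sub_eq_iff_eq_add] at h3
  rw [riccatiMap, h3, mul_add, add_mul, hNW, add_left_comm]
  conv_rhs => rw [← hfix]
  rw [riccatiMap, add_comm]

/-- Test `U = A + (UΦ)* B (UΦ) + Φ* U Φ` on an eigenvector `v` of `Φ`. Modulus at least 1 leaves no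
room for the semidefinite terms, so `‖z‖ = 1`, `A v = 0` and `B U v = 0`. With `w = U v` the
equation reduces to `w = z N* w`, and `W = w w*` works. -/
theorem exists_fixed_direction (hA : A.PosSemidef) (hB : B.PosSemidef)
    {U : Matrix (Fin n) (Fin n) ℂ} (hU : U.PosDef) (hfix : riccatiMap A B N U = U) {z : ℂ}
    (hz : z ∈ spectrum ℂ (closedLoop B N U)) (hz1 : 1 ≤ ‖z‖) :
    ∃ W : Matrix (Fin n) (Fin n) ℂ, W.PosSemidef ∧ W ≠ 0 ∧ B * W = 0 ∧ Nᴴ * W * N = W := by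
  set Φ := closedLoop B N U with hΦ
  obtain ⟨v, hv0, hv⟩ : ∃ v : Fin n → ℂ, v ≠ 0 ∧ Φ *ᵥ v = z • v := by
    rw [spectrum.mem_iff, isUnit_iff_isUnit_det, isUnit_iff_ne_zero, not_not] at hz
    obtain ⟨v, hv0, hv⟩ := exists_mulVec_eq_zero_iff.2 hz
    refine ⟨v, hv0, ?_⟩
    rw [Algebra.algebraMap_eq_smul_one, sub_mulVec, smul_mulVec, one_mulVec, sub_eq_zero] at hv
    exact hv.symm
  set w := U *ᵥ v with hw
  have hUΦ : (U * Φ) *ᵥ v = z • w := by rw [← mulVec_mulVec, hv, mulVec_smul]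
  have hquad : star v ⬝ᵥ (U *ᵥ v) = star v ⬝ᵥ (A *ᵥ v)
      + (star z * z) * (star w ⬝ᵥ (B *ᵥ w)) + (star z * z) * (star v ⬝ᵥ (U *ᵥ v)) := by
    have h := riccatiMap_eq_closedLoop (A := A) (N := N) hB hU
    rw [hfix] at h
    have e1 : star v ⬝ᵥ (((U * Φ)ᴴ * B * (U * Φ)) *ᵥ v)
        = (star z * z) * (star w ⬝ᵥ (B *ᵥ w)) := by
      rw [← mulVec_mulVec, ← mulVec_mulVec, hUΦ, dotProduct_mulVec, ← star_mulVec, hUΦ,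
        mulVec_smul, star_smul, smul_dotProduct, dotProduct_smul, smul_eq_mul, smul_eq_mul,
        mul_assoc]
    have e2 : star v ⬝ᵥ ((Φᴴ * U * Φ) *ᵥ v) = (star z * z) * (star v ⬝ᵥ (U *ᵥ v)) := by
      rw [← mulVec_mulVec, ← mulVec_mulVec, hv, dotProduct_mulVec, ← star_mulVec, hv,
        mulVec_smul, star_smul, smul_dotProduct, dotProduct_smul, smul_eq_mul, smul_eq_mul,
        mul_assoc]
    conv_lhs => rw [h]
    rw [add_mulVec, add_mulVec, dotProduct_add, dotProduct_add, e1, e2]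
  have hzz : star z * z = ((‖z‖ ^ 2 : ℝ) : ℂ) := by
    rw [Complex.star_def, Complex.conj_mul']; norm_cast
  have hUv := hU.dotProduct_mulVec_pos hv0
  have hAv := hA.dotProduct_mulVec_nonneg v
  have hBw := hB.dotProduct_mulVec_nonneg w
  obtain ⟨huv, -⟩ := Complex.pos_iff.1 hUv
  obtain ⟨hav, haim⟩ := Complex.nonneg_iff.1 hAv
  obtain ⟨hbw, hbim⟩ := Complex.nonneg_iff.1 hBw
  have hre := congrArg Complex.re hquad
  rw [hzz] at hre
  simp only [Complex.add_re, Complex.re_ofReal_mul] at hre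
  have hz2 : 1 ≤ ‖z‖ ^ 2 := one_le_pow₀ hz1
  have hz3 : ‖z‖ ^ 2 = 1 := by
    nlinarith [mul_nonneg (sub_nonneg.2 hz2) huv.le,
      mul_nonneg (zero_le_one.trans hz2) hbw]
  rw [hz3] at hre
  have hA0 : A *ᵥ v = 0 := (hA.dotProduct_mulVec_zero_iff v).1
    (Complex.ext (by rw [Complex.zero_re]; linarith) haim.symm)
  have hB0 : B *ᵥ w = 0 := (hB.dotProduct_mulVec_zero_iff w).1
    (Complex.ext (by rw [Complex.zero_re]; linarith) hbim.symm)
  set y := Nᴴ *ᵥ w with hy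
  have hwy : w = z • y := by
    calc w = riccatiMap A B N U *ᵥ v := by rw [hfix]
      _ = z • y := by
        rw [riccatiMap, mul_assoc, ← mul_closedLoop hU, add_mulVec, hA0, zero_add, ← mulVec_mulVec,
          ← hΦ, hUΦ, mulVec_smul]
  have hw0 : w ≠ 0 := by
    intro h
    rw [← hw, h, dotProduct_zero] at hUv
    exact lt_irrefl _ hUv
  refine ⟨vecMulVec w (star w), posSemidef_vecMulVec_self_star w, ?_, ?_, ?_⟩
  · rw [Ne, vecMulVec_eq_zero]
    simpa using hw0
  · rw [mul_vecMulVec, hB0, zero_vecMulVec]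
  · have hyN : star w ᵥ* N = star y := by
      rw [hy, star_mulVec Nᴴ w, conjTranspose_conjTranspose]
    rw [mul_vecMulVec, vecMulVec_mul, ← hy, hyN]
    conv_rhs => rw [hwy]
    rw [star_smul, smul_vecMulVec, vecMulVec_smul, smul_smul, mul_comm, hzz, hz3,
      Complex.ofReal_one, one_smul]

/-- If the positive definite fixed points form a bounded set, then there is at most one of them. -/
theorem riccatiMap_fixed_unique (hA : A.PosSemidef) (hB : B.PosSemidef)
    {T : ℝ} (hT : ∀ X : Matrix (Fin n) (Fin n) ℂ, X.PosDef → riccatiMap A B N X = X → ‖X‖ ≤ T)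
    {U V : Matrix (Fin n) (Fin n) ℂ} (hU : U.PosDef) (hV : V.PosDef)
    (hUfix : riccatiMap A B N U = U) (hVfix : riccatiMap A B N V = V) : V = U := by
  cases subsingleton_or_nontrivial (Matrix (Fin n) (Fin n) ℂ)
  · exact Subsingleton.elim _ _
  have hspec : ∀ z ∈ spectrum ℂ (closedLoop B N U), ‖z‖ < 1 := by
    intro z hz
    by_contra! hz1
    obtain ⟨W, hW, hW0, hBW, hNW⟩ := exists_fixed_direction hA hB hU hUfix hz hz1
    have hWn : 0 < ‖W‖ := norm_pos_iff.2 hW0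
    have hs : ∀ s : ℝ, 0 ≤ s → s * ‖W‖ ≤ T := fun s hs => by
      have hsW : (s • W).PosSemidef := (smul_nonneg hs hW.nonneg).posSemidef
      have hfix := riccatiMap_add_eq_self (A := A) hB hU hUfix hsW
        (by rw [mul_smul_comm, hBW, smul_zero])
        (by rw [mul_smul_comm, smul_mul_assoc, hNW])
      calc s * ‖W‖ = ‖s • W‖ := by rw [norm_smul, Real.norm_of_nonneg hs]
        _ ≤ ‖U + s • W‖ := CStarAlgebra.norm_le_norm_of_nonneg_of_le hsW.nonneg
            (le_add_of_nonneg_left hU.posSemidef.nonneg)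
        _ ≤ T := hT _ (hU.add_posSemidef hsW) hfix
    have h1 := hs ((|T| + 1) / ‖W‖) (by positivity)
    rw [div_mul_cancel₀ _ hWn.ne'] at h1
    linarith [le_abs_self T]
  obtain ⟨K, hK⟩ := exists_norm_pow_le hV (closedLoop_conj_le (N := N) hA hB hV hVfix)
  have hpow : ∀ j : ℕ, V - U
      = (closedLoop B N V ^ j)ᴴ * (V - U) * closedLoop B N U ^ j := fun j => by
    induction j with
    | zero => simp
    | succ j ih =>
      conv_lhs => rw [ih]
      have h := riccatiMap_sub (A := A) (N := N) hB hV hU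
      rw [hVfix, hUfix] at h
      conv_lhs => rw [h]
      rw [pow_succ', pow_succ', conjTranspose_mul]
      simp only [mul_assoc]
  have hlim : Tendsto (fun j : ℕ => K * ‖V - U‖ * ‖closedLoop B N U ^ j‖) atTop (𝓝 0) := by
    have := (tendsto_pow_zero_of_spectrum hspec).norm.const_mul (K * ‖V - U‖)
    simpa using this
  have hle : ‖V - U‖ ≤ 0 := ge_of_tendsto' hlim fun j => by
    conv_lhs => rw [hpow j]
    refine (norm_mul_le _ _).trans (mul_le_mul_of_nonneg_right ?_ (norm_nonneg _))
    refine (norm_mul_le _ _).trans (mul_le_mul_of_nonneg_right ?_ (norm_nonneg _))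
    rw [← star_eq_conjTranspose, norm_star]
    exact hK j
  exact sub_eq_zero.1 (norm_le_zero_iff.1 hle)

end

section

open scoped MatrixOrder

variable {n : ℕ} {A B N : Matrix (Fin n) (Fin n) ℂ}

/-! ### The fixed point criterion -/

theorem IsGloballyAttractingFixedPoint.unique
    {φ : Matrix (Fin n) (Fin n) ℂ → Matrix (Fin n) (Fin n) ℂ} {U V : Matrix (Fin n) (Fin n) ℂ}
    (hU : IsGloballyAttractingFixedPoint φ U) (hV : V.PosDef) (hfix : φ V = V) : V = U := by
  have h := hU.2.2 V hV
  simp only [Function.iterate_fixed hfix] at h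
  exact tendsto_nhds_unique tendsto_const_nhds h

theorem exists_growth_of_attracting (hA : A.PosSemidef) (hB : B.PosSemidef)
    (hAN : (A + Nᴴ * N).PosDef) {U : Matrix (Fin n) (Fin n) ℂ}
    (hU : IsGloballyAttractingFixedPoint (riccatiMap A B N) U) :
    ∃ k l : ℕ, 0 < k ∧ 0 < l ∧
      ‖(fun X => recF B N X + X)^[k] (1 : Matrix (Fin n) (Fin n) ℂ)‖ < 2 ^ k ∧
      ‖(fun X => recLFL A N X + X)^[l] (1 : Matrix (Fin n) (Fin n) ℂ)‖ < 2 ^ l := by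
  have hf := isSubhomogeneous_riccatiMap hA hB hAN
  obtain ⟨k, hk0, hk⟩ := (isRecessionMap_recF (A := A) (N := N)
    hB).exists_norm_add_id_iterate_lt hf hU.1 hU.2.1 fun V hV h => hU.unique hV h
  obtain ⟨l, hl0, hl⟩ := (isRecessionMap_recLFL hA hB hAN).exists_norm_add_id_iterate_lt
    hf.invConj hU.1.inv (by rw [invConj_inv hU.1, hU.2.1]) fun V hV h => by
      have h1 : riccatiMap A B N V⁻¹ = V⁻¹ := by
        have := congrArg (·⁻¹) h
        simpa only [invConj, inv_inv_of_posDef (hf.posDef _ hV.inv)] using this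
      rw [← hU.unique hV.inv h1, inv_inv_of_posDef hV]
  exact ⟨k, l, hk0, hl0, hk, hl⟩

theorem exists_attracting_of_growth (hA : A.PosSemidef) (hB : B.PosSemidef)
    (hAN : (A + Nᴴ * N).PosDef) {k l : ℕ} (hk0 : 0 < k) (hl0 : 0 < l)
    (hk : ‖(fun X => recF B N X + X)^[k] (1 : Matrix (Fin n) (Fin n) ℂ)‖ < 2 ^ k)
    (hl : ‖(fun X => recLFL A N X + X)^[l] (1 : Matrix (Fin n) (Fin n) ℂ)‖ < 2 ^ l) :
    ∃ U : Matrix (Fin n) (Fin n) ℂ, IsGloballyAttractingFixedPoint (riccatiMap A B N) U := by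
  have hf := isSubhomogeneous_riccatiMap hA hB hAN
  have hrec := isRecessionMap_recF (A := A) (N := N) hB
  obtain ⟨Y, hY, hfY⟩ := hrec.exists_map_le hf hk0 hk
  obtain ⟨V, hV, hfV⟩ := (isRecessionMap_recLFL hA hB hAN).exists_map_le hf.invConj hl0 hl
  have hZ : V⁻¹ ≤ riccatiMap A B N V⁻¹ := by
    have := inv_le_inv_of_posDef (hf.invConj.posDef V hV) hfV
    rwa [invConj, inv_inv_of_posDef (hf.posDef _ hV.inv)] at this
  -- Scaling by `τ ≥ 1` puts the supersolution above the subsolution, and subhomogeneity keeps it a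
  -- supersolution.
  obtain ⟨τ, hτ, hle⟩ := exists_one_le_and_le_smul hV.inv hY
  obtain ⟨U, hU, -, hfix, -⟩ := hf.exists_tendsto_of_map_le hV.inv hle
    ((hf.map_smul_le Y τ hY hτ).trans (smul_le_smul_of_nonneg_left hfY (by linarith))) hZ
  obtain ⟨T, hT⟩ := hrec.exists_norm_le_of_fixed hf hk
  exact ⟨U, hf.isGloballyAttractingFixedPoint hU hfix fun W hW h =>
    riccatiMap_fixed_unique hA hB hT hU hW hfix h⟩

/-! ### The sufficient condition: one iteration of each map -/

theorem pinv_nullProj (B : Matrix (Fin n) (Fin n) ℂ) : pinv (nullProj B) = nullProj B := by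
  refine (isMoorePenrose_pinv _).eq ⟨?_, ?_, ?_, ?_⟩ <;>
    simp [nullProj_mul_self, IsHermitian, nullProj_conjTranspose]

theorem norm_add_one_lt {M : Matrix (Fin n) (Fin n) ℂ} (h : ‖M‖ < 1) :
    ‖M + 1‖ < 2 ^ 1 := by
  -- Only an inequality: for `n = 0` the identity has norm 0.
  have h1 : ‖(1 : Matrix (Fin n) (Fin n) ℂ)‖ ≤ 1 :=
    norm_le_of_le_smul_one posDef_one.posSemidef.nonneg zero_le_one (one_smul ℝ _).ge
  have := norm_add_le M 1
  linarith

end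

end Riccati

theorem mainTheorem8 (n : ℕ) (A B N : Matrix (Fin n) (Fin n) ℂ)
    (hA : A.PosSemidef) (hB : B.PosSemidef) (hAN : (A + Nᴴ * N).PosDef) :
    -- `f` maps positive definite matrices to positive definite matrices, and the
    -- recession maps of `f` and `LfL` exist on them and are given by the pseudoinverse formulas
    (∀ X : Matrix (Fin n) (Fin n) ℂ, X.PosDef → (Riccati.riccatiMap A B N X).PosDef) ∧
    Riccati.IsRecessionMap (Riccati.riccatiMap A B N) (Riccati.recF B N) ∧
    Riccati.IsRecessionMap (Riccati.invConj (Riccati.riccatiMap A B N)) (Riccati.recLFL A N) ∧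
    -- a globally attracting fixed point is the only positive definite fixed point
    (∀ U V : Matrix (Fin n) (Fin n) ℂ,
      Riccati.IsGloballyAttractingFixedPoint (Riccati.riccatiMap A B N) U →
      V.PosDef → Riccati.riccatiMap A B N V = V → V = U) ∧
    -- the criterion
    ((∃ U : Matrix (Fin n) (Fin n) ℂ,
        Riccati.IsGloballyAttractingFixedPoint (Riccati.riccatiMap A B N) U) ↔
      ∃ k l : ℕ, 0 < k ∧ 0 < l ∧
        ‖(fun X => Riccati.recF B N X + X)^[k] (1 : Matrix (Fin n) (Fin n) ℂ)‖ < 2 ^ k ∧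
        ‖(fun X => Riccati.recLFL A N X + X)^[l] (1 : Matrix (Fin n) (Fin n) ℂ)‖ < 2 ^ l) ∧
    -- the sufficient condition
    (‖Nᴴ * Riccati.nullProj B * N‖ < 1 →
      ‖Riccati.pinv (Riccati.nullProj A * Nᴴ * N * Riccati.nullProj A)‖ < 1 →
      ∃ U : Matrix (Fin n) (Fin n) ℂ,
        Riccati.IsGloballyAttractingFixedPoint (Riccati.riccatiMap A B N) U) := by
  refine ⟨(Riccati.isSubhomogeneous_riccatiMap hA hB hAN).posDef,
    Riccati.isRecessionMap_recF hB, Riccati.isRecessionMap_recLFL hA hB hAN,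
    fun U V hU hV h => hU.unique hV h,
    ⟨fun ⟨U, hU⟩ => Riccati.exists_growth_of_attracting hA hB hAN hU,
      fun ⟨k, l, hk0, hl0, hk, hl⟩ =>
        Riccati.exists_attracting_of_growth hA hB hAN hk0 hl0 hk hl⟩,
    fun h1 h2 =>
      Riccati.exists_attracting_of_growth (k := 1) (l := 1) hA hB hAN one_pos one_pos ?_ ?_⟩
  · refine Riccati.norm_add_one_lt ?_
    rwa [Riccati.recF, inv_one, mul_one, Riccati.nullProj_mul_self, Riccati.pinv_nullProj]
  · refine Riccati.norm_add_one_lt ?_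
    rwa [Riccati.recLFL, inv_one, mul_one]
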